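/- Work in the first-order language with binary membership $\in$ and a unary predicate $\mathscr A$ for urelements (a set is an object that is not an urelement). Let $\mathrm{ZFU_R}$ be the theory whose axioms are: urelements have no members, Extensionality for sets, Foundation, Pairing, Union, Powerset, Infinity, and the schemes of Separation and Replacement (the urelements may form a proper class, and Collection is not assumed). For sets $x,y$ write $x\sim y$ if there is a bijection between $x$ and $y$. Cardinality is parametrically representable if there are a formula $\varphi$ and an object $p$ such that $\varphi(\cdot,\cdot,p)$ defines a function $x\mapsto|x|$ on the class of all sets with $x\sim y\leftrightarrow |x|=|y|$ and $x\sim|x|$ for all sets $x,y$. Plenitude$^+$ says that every set is equinumerous with a set of urelements. The Reflection Principle is the scheme which says, for every formula $\varphi(x_1,\dots,x_n)$: for every set $x$ there is a transitive set $t$ with $x\subseteq t$ such that for all $x_1,\dots,x_n\in t$, $\varphi(x_1,\dots,x_n)\leftrightarrow\varphi^t(x_1,\dots,x_n)$, where $\varphi^t$ is the relativization of $\varphi$ to $t$. Theorem. Over $\mathrm{ZFU_R}$, if cardinality is parametrically representable, then Plenitude$^+$ implies the Reflection Principle. That is, every model of $\mathrm{ZFU_R}$ in which cardinality is parametrically representable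 and Plenitude$^+$ holds satisfies every instance of the Reflection Principle. -/

import Mathlib

/-! Set theory with urelements: the first-order language with membership and a unary predicate for
urelements, the theory ZF with urelements (formulated with Replacement), and the principles
involved. Everything is evaluated in an arbitrary first-order structure `M`; in particular
equinumerosity is witnessed by bijections that are elements of `M`. -/

namespace Urelement

/-- The non-logical symbols: a unary predicate for urelements and binary membership. -/
inductive Symb : ℕ → Type
  | ure : Symb 1
  | mem : Symb 2

/-- The language of urelement set theory. -/
def lang : FirstOrder.Language.{0, 0} := ⟨fun _ => Empty, Symb⟩

section Basic

variable {M : Type*} [lang.Structure M]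

/-- `x` is an urelement. -/
def IsUr (x : M) : Prop :=
  FirstOrder.Language.Structure.RelMap (L := lang) (Symb.ure : lang.Relations 1) ![x]

/-- `x` is a member of `y`. -/
def Mem (x y : M) : Prop :=
  FirstOrder.Language.Structure.RelMap (L := lang) (Symb.mem : lang.Relations 2) ![x, y]

/-- `x` is a set, that is, not an urelement. -/
def IsSet (x : M) : Prop := ¬ IsUr x

/-- Every member of `x` is a member of `y`. -/
def Sub (x y : M) : Prop := ∀ z : M, Mem z x → Mem z y

/-- `u = {a, b}`. -/
def IsUPair (u a b : M) : Prop := ∀ z : M, Mem z u ↔ z = a ∨ z = b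

/-- `q` is the Kuratowski pair `{{a}, {a, b}}`. -/
def IsOPair (q a b : M) : Prop :=
  ∃ s d : M, IsUPair s a a ∧ IsUPair d a b ∧ IsUPair q s d

/-- The ordered pair of `a` and `b` is a member of `f`. -/
def PairMem (f a b : M) : Prop := ∃ q : M, IsOPair q a b ∧ Mem q f

/-- In `M`, the set `f` is a bijection from `x` onto `y`. -/
def IsBij (f x y : M) : Prop :=
  IsSet f ∧
  (∀ q : M, Mem q f → ∃ a b : M, Mem a x ∧ Mem b y ∧ IsOPair q a b) ∧
  (∀ a : M, Mem a x → ∃! b : M, PairMem f a b) ∧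
  (∀ b : M, Mem b y → ∃! a : M, PairMem f a b)

/-- `x` and `y` are sets, and in `M` there is a bijection between them. -/
def Equinum (x y : M) : Prop := IsSet x ∧ IsSet y ∧ ∃ f : M, IsBij f x y

/-- `A` is a set all of whose members are urelements. -/
def IsSetOfUr (A : M) : Prop := IsSet A ∧ ∀ a : M, Mem a A → IsUr a

/-- `t` is a transitive set. -/
def IsTransSet (t : M) : Prop := IsSet t ∧ ∀ y : M, Mem y t → ∀ z : M, Mem z y → Mem z t

end Basic

open FirstOrder FirstOrder.Language in
/-- The relativization of a formula: a new free variable `none` is added, and every quantifier is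
bounded by it. So `relativize φ`, with `none` interpreted as `t`, is the formula usually denoted
by `φ` with superscript `t`. -/
def relativize {α : Type} : {n : ℕ} → lang.BoundedFormula α n → lang.BoundedFormula (Option α) n
  | _, .falsum => .falsum
  | _, .equal s₁ s₂ => .equal (s₁.relabel (Sum.map some id)) (s₂.relabel (Sum.map some id))
  | _, .rel R ts => .rel R (fun i => (ts i).relabel (Sum.map some id))
  | _, .imp f g => .imp (relativize f) (relativize g)
  | n, .all f =>
      .all (.imp
        (.rel (Symb.mem : lang.Relations 2)
          ![Term.var (Sum.inr (Fin.last n)), Term.var (Sum.inl none)])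
        (relativize f))

section Theory

variable (M : Type*) [lang.Structure M]

/-- `M` is a model of ZF with urelements, with the Replacement scheme (and not Collection). The two
schemes range over all classes and class relations that are definable by a first-order formula with
finitely many parameters from `M`. -/
structure IsModelZFUR : Prop where
  /-- No urelement has a member. -/
  urelement : ∀ x : M, IsUr x → ∀ y : M, ¬ Mem y x
  /-- Extensionality for sets. -/
  extensionality : ∀ x y : M, IsSet x → IsSet y → (∀ z : M, Mem z x ↔ Mem z y) → x = y
  /-- Foundation. -/
  foundation : ∀ x : M, (∃ y : M, Mem y x) → ∃ y : M, Mem y x ∧ ∀ z : M, Mem z y → ¬ Mem z x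
  /-- Pairing. -/
  pairing : ∀ a b : M, ∃ u : M, IsSet u ∧ IsUPair u a b
  /-- Union. -/
  union : ∀ x : M, IsSet x → ∃ u : M, IsSet u ∧ ∀ z : M, Mem z u ↔ ∃ y : M, Mem y x ∧ Mem z y
  /-- Powerset. -/
  powerset : ∀ x : M, IsSet x → ∃ u : M, IsSet u ∧ ∀ z : M, Mem z u ↔ IsSet z ∧ Sub z x
  /-- Infinity. -/
  infinity : ∃ w : M, IsSet w ∧
    (∃ e : M, Mem e w ∧ IsSet e ∧ ∀ z : M, ¬ Mem z e) ∧
    ∀ x : M, Mem x w → ∃ y : M, Mem y w ∧ IsSet y ∧ ∀ z : M, Mem z y ↔ Mem z x ∨ z = x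
  /-- The Separation scheme. -/
  separation : ∀ S : Set M, (Set.univ : Set M).Definable₁ lang S →
    ∀ x : M, IsSet x → ∃ u : M, IsSet u ∧ ∀ z : M, Mem z u ↔ Mem z x ∧ z ∈ S
  /-- The Replacement scheme. -/
  replacement : ∀ R : Set (M × M), (Set.univ : Set M).Definable₂ lang R →
    ∀ w : M, IsSet w → (∀ x : M, Mem x w → ∃! y : M, (x, y) ∈ R) →
      ∃ v : M, IsSet v ∧ ∀ y : M, Mem y v ↔ ∃ x : M, Mem x w ∧ (x, y) ∈ R

/-- Cardinality is parametrically representable in `M`: some function assigning to every set `x` of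
`M` a value `card x`, defined in `M` by a first-order formula with a parameter `p`, satisfies
`x ~ y ↔ card x = card y` and `x ~ card x` for all sets `x`, `y`. (Values of `card` at urelements
are irrelevant.) -/
def CardParamRepresentable : Prop :=
  ∃ (p : M) (card : M → M),
    ({p} : Set M).Definable₂ lang {q : M × M | IsSet q.1 ∧ q.2 = card q.1} ∧
    (∀ x y : M, IsSet x → IsSet y → (Equinum x y ↔ card x = card y)) ∧
    ∀ x : M, IsSet x → Equinum x (card x)

/-- Every set is equinumerous with a set of urelements. -/
def PlenitudePlus : Prop :=
  ∀ x : M, IsSet x → ∃ A : M, IsSetOfUr A ∧ Equinum x A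

/-- The Reflection Principle, a scheme: for every formula `φ` in the variables `x₁, …, xₙ`, every
set `x` is included in a transitive set `t` such that `φ` and its relativization to `t` agree at all
`x₁, …, xₙ ∈ t`. -/
def ReflectionPrinciple : Prop :=
  ∀ (n : ℕ) (φ : lang.Formula (Fin n)) (x : M), IsSet x →
    ∃ t : M, IsTransSet t ∧ Sub x t ∧
      ∀ v : Fin n → M, (∀ i, Mem (v i) t) →
        (φ.Realize v ↔
          FirstOrder.Language.Formula.Realize (relativize φ) (fun o => Option.elim o t v))

end Theory

end Urelement

/-! Without Collection, witnesses cannot simply be gathered: witnesses of bounded rank may involve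
urelements from a proper class. The remedy is that urelements outside a given set are indiscernible.
If `C` and `D` are equinumerous sets of urelements disjoint from `X`, some automorphism carries `C`
to `D` and fixes everything built over `X` (`exists_automorphism_fixing`). Plenitude⁺ supplies the
fresh copies that this needs (`exists_disjoint_copy`).

Applied to single urelements, indiscernibility shows that every value of the cardinality function is
built over the urelements of its parameter (`exists_copy_over`). So, for a suitable set `B` of
urelements, all sizes are represented by sets in the hierarchy over `B`, where Replacement does
bound things.

Write V_s(B) for `level s B`. Let `D` be a fresh set of urelements of the size of V_s(B), and take
parameters from V_s(B ∪ D). A witness uses some additional set `C` of urelements, and the size of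
`C` is realized by a subset `c` of some V_r(B), disjoint from V_s(B). A single `r` serves all
parameters, and by homogeneity all `D` (`exists_step`). Taking such an `r` of least rank makes
V_r(B) definable from `s`, so the step can be iterated ω times without choice, giving a set `T` of
indices (`exists_stepFormula_orbit`).

Finally fix one bijection `g` from V_T(B) onto a fresh set of urelements, and let `t` be the union
of the V_s(B ∪ g[V_s(B)]) for `s` in `T`. A witness for parameters from stage `s` can be moved by an
automorphism that fixes the parameters and sends `C` to g[c], hence into stage `r`
(`exists_mem_growingLevel`). So `t` passes the Tarski–Vaught test (`realize_relativize`). -/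

namespace Urelement

open FirstOrder FirstOrder.Language

/-! ### Definability with parameters, arranged so that instance search proves it -/

section Definability

variable {M : Type*} [lang.Structure M] {A : Set M} {ι κ : Type}

/-- The predicate `P` is definable with parameters from `A`. -/
class Dfn (A : Set M) (P : (ι → M) → Prop) : Prop where
  definable : A.Definable lang {v | P v}

/-- The function `t` is definable with parameters from `A`. -/
class DfnFun (A : Set M) (t : (ι → M) → M) : Prop where
  definable : A.DefinableFun lang t

namespace Dfn

variable {P Q : (ι → M) → Prop}

theorem congr [h : Dfn A Q] (hPQ : ∀ v, P v ↔ Q v) : Dfn A P :=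
  ⟨by simpa only [hPQ] using h.definable⟩

instance and [hP : Dfn A P] [hQ : Dfn A Q] : Dfn A (fun v => P v ∧ Q v) :=
  ⟨hP.definable.inter hQ.definable⟩

instance or [hP : Dfn A P] [hQ : Dfn A Q] : Dfn A (fun v => P v ∨ Q v) :=
  ⟨hP.definable.union hQ.definable⟩

instance not [hP : Dfn A P] : Dfn A (fun v => ¬ P v) :=
  ⟨hP.definable.compl⟩

instance imp [Dfn A P] [Dfn A Q] : Dfn A (fun v => P v → Q v) :=
  congr (Q := fun v => ¬ P v ∨ Q v) fun _ => imp_iff_not_or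

instance iff [Dfn A P] [Dfn A Q] : Dfn A (fun v => P v ↔ Q v) :=
  congr (Q := fun v => (P v → Q v) ∧ (Q v → P v)) fun _ => iff_iff_implies_and_implies

instance const (p : Prop) : Dfn A (fun _ : ι → M => p) := by
  by_cases h : p
  · exact ⟨by simp only [h]; exact Set.definable_univ⟩
  · exact ⟨by simp only [h]; exact Set.definable_empty⟩

instance forall_tuple [Finite κ] {P : (ι → M) → (κ → M) → Prop}
    [h : Dfn A (fun w : ι ⊕ κ → M => P (fun i => w (Sum.inl i)) (fun k => w (Sum.inr k)))] :
    Dfn A (fun v => ∀ u : κ → M, P v u) :=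
  ⟨h.definable.forall_of_finite⟩

instance exists_tuple [Finite κ] {P : (ι → M) → (κ → M) → Prop}
    [h : Dfn A (fun w : ι ⊕ κ → M => P (fun i => w (Sum.inl i)) (fun k => w (Sum.inr k)))] :
    Dfn A (fun v => ∃ u : κ → M, P v u) :=
  ⟨h.definable.exists_of_finite⟩

theorem relabel (h : Dfn A P) (f : ι → κ) : Dfn A (fun v : κ → M => P (fun i => v (f i))) :=
  ⟨h.definable.preimage_comp f⟩

instance ex {P : (ι → M) → M → Prop}
    [h : Dfn A (fun w : Option ι → M => P (fun i => w (some i)) (w none))] :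
    Dfn A (fun v => ∃ x : M, P v x) :=
  have := h.relabel (fun o => Option.elim o (Sum.inr ()) Sum.inl : Option ι → ι ⊕ Unit)
  have : Dfn A (fun v => ∃ u : Unit → M, P v (u ())) := exists_tuple (h := this)
  congr (Q := fun v => ∃ u : Unit → M, P v (u ())) fun _ => ⟨fun ⟨x, hx⟩ => ⟨fun _ => x, hx⟩, fun ⟨u, hu⟩ => ⟨u (), hu⟩⟩

instance all {P : (ι → M) → M → Prop}
    [Dfn A (fun w : Option ι → M => P (fun i => w (some i)) (w none))] :
    Dfn A (fun v => ∀ x : M, P v x) :=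
  congr (Q := fun v => ¬ ∃ x : M, ¬ P v x) fun _ => by simp

instance existsUnique {P : (ι → M) → M → Prop}
    [h : Dfn A (fun v => ∃ x, P v x ∧ ∀ y, P v y → y = x)] : Dfn A (fun v => ∃! x : M, P v x) :=
  h

theorem comp [Finite κ] {R : (κ → M) → Prop} (h : Dfn A R) {t : κ → (ι → M) → M}
    (ht : ∀ k, DfnFun A (t k)) : Dfn A (fun v => R (fun k => t k v)) :=
  ⟨h.definable.preimage_map (F := fun v k => t k v) fun k => (ht k).definable⟩

theorem comp₁ {R : M → Prop} (h : Dfn A (fun v : Fin 1 → M => R (v 0)))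
    {t : (ι → M) → M} [ht : DfnFun A t] : Dfn A (fun v => R (t v)) :=
  h.comp (t := ![t]) (by simpa [Fin.forall_fin_one] using! ht)

theorem comp₂ {R : M → M → Prop} (h : Dfn A (fun v : Fin 2 → M => R (v 0) (v 1)))
    {t s : (ι → M) → M} [ht : DfnFun A t] [hs : DfnFun A s] : Dfn A (fun v => R (t v) (s v)) :=
  h.comp (t := ![t, s]) (by simpa [Fin.forall_fin_two] using! ⟨ht, hs⟩)

theorem comp₃ {R : M → M → M → Prop} (h : Dfn A (fun v : Fin 3 → M => R (v 0) (v 1) (v 2)))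
    {t s r : (ι → M) → M} [ht : DfnFun A t] [hs : DfnFun A s] [hr : DfnFun A r] :
    Dfn A (fun v => R (t v) (s v) (r v)) :=
  h.comp (t := ![t, s, r]) (by simpa [Fin.forall_fin_succ] using! ⟨ht, hs, hr⟩)

theorem comp₄ {R : M → M → M → M → Prop}
    (h : Dfn A (fun v : Fin 4 → M => R (v 0) (v 1) (v 2) (v 3)))
    {t s r q : (ι → M) → M} [ht : DfnFun A t] [hs : DfnFun A s] [hr : DfnFun A r]
    [hq : DfnFun A q] : Dfn A (fun v => R (t v) (s v) (r v) (q v)) :=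
  h.comp (t := ![t, s, r, q]) (by simpa [Fin.forall_fin_succ] using! ⟨ht, hs, hr, hq⟩)

theorem mono {B : Set M} (h : Dfn A P) (hAB : A ⊆ B) : Dfn B P :=
  ⟨h.definable.mono hAB⟩

/-- A predicate that is definable over `A` is invariant under automorphisms that fix `A`. -/
theorem map_iff (h : Dfn A P) (σ : M ≃[lang] M) (hσ : ∀ a ∈ A, σ a = a) (v : ι → M) :
    P (fun i => σ (v i)) ↔ P v := by
  obtain ⟨φ, hφ⟩ := Set.definable_iff_exists_formula_sum.1 h.definable
  have key : ∀ v, P v ↔ φ.Realize (Sum.elim (fun a : A => (a : M)) v) := fun v => by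
    have := Set.ext_iff.1 hφ v
    exact this
  rw [key, key, ← StrongHomClass.realize_formula σ φ (v := Sum.elim (fun a : A => (a : M)) v)]
  refine iff_of_eq (congrArg _ ?_)
  funext i
  rcases i with a | i
  · exact (hσ a a.2).symm
  · rfl

end Dfn

namespace DfnFun

instance var (i : ι) : DfnFun A (fun v : ι → M => v i) := ⟨Set.DefinableFun.proj lang⟩

instance const (c : M) : DfnFun (Set.univ : Set M) (fun _ : ι → M => c) :=
  ⟨lang.definableFun_const ι (Set.mem_univ c)⟩

theorem of_graph {t : (ι → M) → M}
    (h : Dfn A (fun w : Option ι → M => w none = t (fun i => w (some i)))) : DfnFun A t :=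
  by
  have : t.tupleGraph = {w : Option ι → M | w none = t (fun i => w (some i))} := by
    ext w; exact eq_comm
  exact ⟨by rw [Set.DefinableFun, this]; exact h.definable⟩

theorem comp [Finite κ] {F : (κ → M) → M} (h : DfnFun A F) {t : κ → (ι → M) → M}
    (ht : ∀ k, DfnFun A (t k)) : DfnFun A (fun v => F (fun k => t k v)) :=
  ⟨Set.DefinableFun.comp (g := fun v k => t k v) (fun k => (ht k).definable) h.definable⟩

theorem comp₁ {F : M → M} (h : DfnFun A (fun v : Fin 1 → M => F (v 0)))
    {t : (ι → M) → M} [ht : DfnFun A t] : DfnFun A (fun v => F (t v)) :=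
  h.comp (t := ![t]) (by simpa [Fin.forall_fin_one] using! ht)

theorem comp₂ {F : M → M → M} (h : DfnFun A (fun v : Fin 2 → M => F (v 0) (v 1)))
    {t s : (ι → M) → M} [ht : DfnFun A t] [hs : DfnFun A s] : DfnFun A (fun v => F (t v) (s v)) :=
  h.comp (t := ![t, s]) (by simpa [Fin.forall_fin_two] using! ⟨ht, hs⟩)

end DfnFun

instance Dfn.eq {t s : (ι → M) → M} [ht : DfnFun A t] [hs : DfnFun A s] :
    Dfn A (fun v => t v = s v) :=
  ⟨ht.definable.ofPred_eq hs.definable⟩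

theorem Dfn.relMap {n : ℕ} (R : lang.Relations n) :
    Dfn A (fun v : Fin n → M => Structure.RelMap R v) :=
  Dfn.mono (A := ∅) ⟨Set.empty_definable_iff.2
    ⟨R.formula fun i => Term.var i, by ext v; simp [Formula.realize_rel]⟩⟩ (Set.empty_subset A)

instance Dfn.isUr {t : (ι → M) → M} [DfnFun A t] : Dfn A (fun v => IsUr (t v)) :=
  Dfn.comp₁ <| by
    have := Dfn.relMap (M := M) (A := A) (Symb.ure : lang.Relations 1)
    exact Dfn.congr fun v => by rw [IsUr, ← FinVec.etaExpand_eq v]; rfl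

instance Dfn.mem {t s : (ι → M) → M} [DfnFun A t] [DfnFun A s] :
    Dfn A (fun v => Mem (t v) (s v)) :=
  Dfn.comp₂ <| by
    have := Dfn.relMap (M := M) (A := A) (Symb.mem : lang.Relations 2)
    exact Dfn.congr fun v => by rw [Mem, ← FinVec.etaExpand_eq v]; rfl

instance Dfn.isSet {t : (ι → M) → M} [DfnFun A t] : Dfn A (fun v => IsSet (t v)) := Dfn.not

instance Dfn.sub {t s : (ι → M) → M} [DfnFun A t] [DfnFun A s] :
    Dfn A (fun v => Sub (t v) (s v)) :=
  Dfn.comp₂ (by unfold Sub; infer_instance)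

instance Dfn.isUPair {t s r : (ι → M) → M} [DfnFun A t] [DfnFun A s] [DfnFun A r] :
    Dfn A (fun v => IsUPair (t v) (s v) (r v)) :=
  Dfn.comp₃ (by unfold IsUPair; infer_instance)

instance Dfn.isOPair {t s r : (ι → M) → M} [DfnFun A t] [DfnFun A s] [DfnFun A r] :
    Dfn A (fun v => IsOPair (t v) (s v) (r v)) :=
  Dfn.comp₃ (by unfold IsOPair; infer_instance)

instance Dfn.pairMem {t s r : (ι → M) → M} [DfnFun A t] [DfnFun A s] [DfnFun A r] :
    Dfn A (fun v => PairMem (t v) (s v) (r v)) :=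
  Dfn.comp₃ (by unfold PairMem; infer_instance)

instance Dfn.isBij {t s r : (ι → M) → M} [DfnFun A t] [DfnFun A s] [DfnFun A r] :
    Dfn A (fun v => IsBij (t v) (s v) (r v)) :=
  Dfn.comp₃ (by unfold IsBij; infer_instance)

instance Dfn.equinum {t s : (ι → M) → M} [DfnFun A t] [DfnFun A s] :
    Dfn A (fun v => Equinum (t v) (s v)) :=
  Dfn.comp₂ (by unfold Equinum; infer_instance)

instance Dfn.isSetOfUr {t : (ι → M) → M} [DfnFun A t] : Dfn A (fun v => IsSetOfUr (t v)) :=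
  Dfn.comp₁ (by unfold IsSetOfUr; infer_instance)

instance Dfn.isTransSet {t : (ι → M) → M} [DfnFun A t] : Dfn A (fun v => IsTransSet (t v)) :=
  Dfn.comp₁ (by unfold IsTransSet; infer_instance)

end Definability

/-! ### Elementary set theory inside the model -/

section Sets

variable {M : Type*} [lang.Structure M] {A : Set M} {ι : Type}

open Classical in
/-- The set of all `z` with `P z`, provided that it exists. -/
noncomputable def compr [hM : Fact (IsModelZFUR M)] (P : M → Prop) : M :=
  if h : ∃ u : M, IsSet u ∧ ∀ z, Mem z u ↔ P z then h.choose
  else (hM.out.infinity.choose_spec.2.1).choose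

variable [hM : Fact (IsModelZFUR M)]

theorem ext_of_isSet {x y : M} (hx : IsSet x) (hy : IsSet y) (h : ∀ z, Mem z x ↔ Mem z y) :
    x = y :=
  hM.out.extensionality x y hx hy h

theorem isSet_of_mem {x y : M} (h : Mem x y) : IsSet y :=
  fun hy => hM.out.urelement y hy x h

theorem isSet_compr (P : M → Prop) : IsSet (compr P) := by
  unfold compr
  split_ifs with h
  · exact h.choose_spec.1
  · exact (hM.out.infinity.choose_spec.2.1).choose_spec.2.1

theorem mem_compr_of_exists {P : M → Prop} (h : ∃ u : M, IsSet u ∧ ∀ z, Mem z u ↔ P z) (z : M) :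
    Mem z (compr P) ↔ P z := by
  rw [compr, dif_pos h]
  exact h.choose_spec.2 z

theorem compr_eq_of_not_exists {P : M → Prop} (h : ¬ ∃ u : M, IsSet u ∧ ∀ z, Mem z u ↔ P z)
    (z : M) : ¬ Mem z (compr P) := by
  rw [compr, dif_neg h]
  exact (hM.out.infinity.choose_spec.2.1).choose_spec.2.2 z

/-- Giving the junk case a first-order description, too, makes the graph of `compr` definable
whenever `P` is; no existence proof is then needed to know that a term is definable. -/
theorem eq_compr_iff {P : M → Prop} {y : M} : y = compr P ↔ IsSet y ∧
    ((∀ z, Mem z y ↔ P z) ∨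
      (¬ ∃ u : M, IsSet u ∧ ∀ z, Mem z u ↔ P z) ∧ ∀ z, ¬ Mem z y) := by
  constructor
  · rintro rfl
    refine ⟨isSet_compr P, ?_⟩
    by_cases h : ∃ u : M, IsSet u ∧ ∀ z, Mem z u ↔ P z
    · exact Or.inl (mem_compr_of_exists h)
    · exact Or.inr ⟨h, compr_eq_of_not_exists h⟩
  · rintro ⟨hy, h | ⟨h, h'⟩⟩
    · refine ext_of_isSet hy (isSet_compr P) fun z => ?_
      rw [h, mem_compr_of_exists ⟨y, hy, h⟩]
    · exact ext_of_isSet hy (isSet_compr P) fun z =>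
        iff_of_false (h' z) (compr_eq_of_not_exists h z)

instance DfnFun.compr {P : (ι → M) → M → Prop}
    [h : Dfn A (fun w : Option ι → M => P (fun i => w (some i)) (w none))] :
    DfnFun A (fun v => compr (P v)) :=
  DfnFun.of_graph <| by
    have : Dfn A (fun w : Option (Option ι) → M => P (fun i => w (some (some i))) (w none)) :=
      h.relabel (fun o => o.elim none fun i => some (some i))
    have : Dfn A (fun w : Option (Option (Option ι)) → M =>
        P (fun i => w (some (some (some i)))) (w none)) :=
      h.relabel (fun o => o.elim none fun i => some (some (some i)))
    simp only [eq_compr_iff]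
    infer_instance

theorem exists_isSet_empty : ∃ e : M, IsSet e ∧ ∀ z, ¬ Mem z e := by
  obtain ⟨w, -, ⟨e, -, he⟩, -⟩ := hM.out.infinity
  exact ⟨e, he⟩

/-- A set with the same members as `x`. -/
theorem exists_isSet_same (x : M) : ∃ u : M, IsSet u ∧ ∀ z, Mem z u ↔ Mem z x := by
  by_cases hx : IsSet x
  · exact ⟨x, hx, fun _ => Iff.rfl⟩
  · obtain ⟨e, he, h⟩ := exists_isSet_empty (M := M)
    exact ⟨e, he, fun z => iff_of_false (h z) fun hz => hx (isSet_of_mem hz)⟩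

theorem mem_compr {P : M → Prop} [h : Dfn Set.univ (fun v : Fin 1 → M => P (v 0))] {x : M}
    (hx : ∀ z, P z → Mem z x) (z : M) : Mem z (compr P) ↔ P z := by
  apply mem_compr_of_exists
  obtain ⟨x', hx', hxx'⟩ := exists_isSet_same x
  obtain ⟨u, hu, hu'⟩ := hM.out.separation {z | P z} h.definable x' hx'
  refine ⟨u, hu, fun z => (hu' z).trans ?_⟩
  rw [hxx']
  exact ⟨fun h => h.2, fun h => ⟨hx z h, h⟩⟩

/-- The empty set. -/
noncomputable def emp : M := compr fun _ => False

theorem isSet_emp : IsSet (emp : M) := isSet_compr _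

theorem not_mem_emp (z : M) : ¬ Mem z (emp : M) := by
  obtain ⟨e, he, h⟩ := exists_isSet_empty (M := M)
  rw [emp, mem_compr_of_exists ⟨e, he, fun z => iff_of_false (h z) id⟩]
  exact id

instance DfnFun.emp : DfnFun A (fun _ : ι → M => (emp : M)) := by
  unfold Urelement.emp; infer_instance

theorem eq_emp {x : M} (hx : IsSet x) (h : ∀ z, ¬ Mem z x) : x = emp :=
  ext_of_isSet hx isSet_emp fun z => iff_of_false (h z) (not_mem_emp z)

/-- The unordered pair of `a` and `b`. -/
noncomputable def upair (a b : M) : M := compr fun z => z = a ∨ z = b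

instance DfnFun.upair {t s : (ι → M) → M} [DfnFun A t] [DfnFun A s] :
    DfnFun A (fun v => upair (t v) (s v)) :=
  DfnFun.comp₂ (by unfold Urelement.upair; infer_instance)

theorem isSet_upair (a b : M) : IsSet (upair a b) := isSet_compr _

theorem mem_upair {a b z : M} : Mem z (upair a b) ↔ z = a ∨ z = b :=
  mem_compr_of_exists (hM.out.pairing a b) z

theorem isUPair_iff {u a b : M} : IsUPair u a b ↔ u = upair a b := by
  constructor
  · intro h
    exact ext_of_isSet (isSet_of_mem ((h a).2 (Or.inl rfl))) (isSet_upair a b) fun z => by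
      rw [h, mem_upair]
  · rintro rfl z
    exact mem_upair

/-- The ordered pair of `a` and `b`. -/
noncomputable def pr (a b : M) : M := upair (upair a a) (upair a b)

instance DfnFun.pr {t s : (ι → M) → M} [DfnFun A t] [DfnFun A s] :
    DfnFun A (fun v => pr (t v) (s v)) :=
  DfnFun.comp₂ (by unfold Urelement.pr; infer_instance)

theorem isOPair_iff {q a b : M} : IsOPair q a b ↔ q = pr a b := by
  simp [IsOPair, isUPair_iff, pr]

theorem pairMem_iff {f a b : M} : PairMem f a b ↔ Mem (pr a b) f := by
  simp [PairMem, isOPair_iff]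

theorem upair_inj {a b c d : M} (h : upair a b = upair c d) :
    a = c ∧ b = d ∨ a = d ∧ b = c := by
  have h1 : ∀ z : M, (z = a ∨ z = b) ↔ (z = c ∨ z = d) := fun z => by
    rw [← mem_upair, h, mem_upair]
  have ha := (h1 a).1 (Or.inl rfl)
  have hb := (h1 b).1 (Or.inr rfl)
  have hc := (h1 c).2 (Or.inl rfl)
  have hd := (h1 d).2 (Or.inr rfl)
  grind

theorem pr_inj {a b c d : M} : pr a b = pr c d ↔ a = c ∧ b = d := by
  constructor
  · intro h
    have := upair_inj h
    have h1 := fun h => upair_inj (M := M) (a := a) (b := a) (c := c) (d := c) h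
    have h2 := fun h => upair_inj (M := M) (a := a) (b := b) (c := c) (d := d) h
    have h3 := fun h => upair_inj (M := M) (a := a) (b := a) (c := c) (d := d) h
    have h4 := fun h => upair_inj (M := M) (a := a) (b := b) (c := c) (d := c) h
    grind
  · rintro ⟨rfl, rfl⟩
    rfl

/-- The union of `x`. -/
noncomputable def sUnion (x : M) : M := compr fun z => ∃ y, Mem y x ∧ Mem z y

instance DfnFun.sUnion {t : (ι → M) → M} [DfnFun A t] : DfnFun A (fun v => sUnion (t v)) :=
  DfnFun.comp₁ (by unfold Urelement.sUnion; infer_instance)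

theorem mem_sUnion {x z : M} : Mem z (sUnion x) ↔ ∃ y, Mem y x ∧ Mem z y := by
  refine mem_compr_of_exists ?_ z
  obtain ⟨x', hx', h⟩ := exists_isSet_same x
  simpa only [h] using! hM.out.union x' hx'

/-- The union of `x` and `y`. -/
noncomputable def union (x y : M) : M := compr fun z => Mem z x ∨ Mem z y

instance DfnFun.union {t s : (ι → M) → M} [DfnFun A t] [DfnFun A s] :
    DfnFun A (fun v => union (t v) (s v)) :=
  DfnFun.comp₂ (by unfold Urelement.union; infer_instance)

theorem isSet_union (x y : M) : IsSet (union x y) := isSet_compr _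

theorem mem_union {x y z : M} : Mem z (union x y) ↔ Mem z x ∨ Mem z y :=
  mem_compr_of_exists ⟨sUnion (upair x y), isSet_compr _, fun z => by
    simp [mem_sUnion, mem_upair]⟩ z

/-- The set of all subsets of `x`. -/
noncomputable def power (x : M) : M := compr fun z => IsSet z ∧ Sub z x

theorem mem_power {x z : M} : Mem z (power x) ↔ IsSet z ∧ Sub z x := by
  refine mem_compr_of_exists ?_ z
  obtain ⟨x', hx', h⟩ := exists_isSet_same x
  simpa only [Sub, h] using! hM.out.powerset x' hx'

theorem exists_replacement (R : M → M → Prop)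
    [h : Dfn Set.univ (fun v : Fin 2 → M => R (v 0) (v 1))] (w : M)
    (hR : ∀ x, Mem x w → ∃! y, R x y) : ∃ v : M, IsSet v ∧ ∀ y, Mem y v ↔ ∃ x, Mem x w ∧ R x y := by
  obtain ⟨w', hw', hww'⟩ := exists_isSet_same w
  have := hM.out.replacement {q | R q.1 q.2} h.definable w' hw'
  simp only [hww'] at this
  exact this hR

/-- The set of all pairs of elements of `x` and `y` that are related by `R`. -/
noncomputable def relSet (x y : M) (R : M → M → Prop) : M :=
  compr fun q => ∃ a b, Mem a x ∧ Mem b y ∧ R a b ∧ q = pr a b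

theorem mem_relSet {x y : M} {R : M → M → Prop}
    [h : Dfn Set.univ (fun v : Fin 2 → M => R (v 0) (v 1))] {q : M} :
    Mem q (relSet x y R) ↔ ∃ a b, Mem a x ∧ Mem b y ∧ R a b ∧ q = pr a b := by
  -- This makes the definability of `R` available to instance search for arbitrary definable
  -- arguments in any variable context. The same device recurs below.
  have := fun {ι : Type} => @Dfn.comp₂ M _ _ ι R h
  refine mem_compr (P := fun q => ∃ a b, Mem a x ∧ Mem b y ∧ R a b ∧ q = pr a b)
    (x := power (power (union x y))) ?_ q
  rintro q ⟨a, b, ha, hb, -, rfl⟩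
  simp only [mem_power, Sub, pr, mem_upair, mem_union, true_and, isSet_upair]
  rintro z (rfl | rfl) <;> simp only [isSet_upair, mem_upair, true_and] <;> rintro z (rfl | rfl) <;>
    simp [ha, hb]

theorem pairMem_relSet {x y : M} {R : M → M → Prop}
    [Dfn Set.univ (fun v : Fin 2 → M => R (v 0) (v 1))] {a b : M} :
    PairMem (relSet x y R) a b ↔ Mem a x ∧ Mem b y ∧ R a b := by
  rw [pairMem_iff, mem_relSet]
  constructor
  · rintro ⟨a', b', ha, hb, hR, h⟩
    obtain ⟨rfl, rfl⟩ := pr_inj.1 h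
    exact ⟨ha, hb, hR⟩
  · exact fun ⟨ha, hb, hR⟩ => ⟨a, b, ha, hb, hR, rfl⟩

theorem IsBij.mem_of_pairMem {f x y a b : M} (hf : IsBij f x y) (h : PairMem f a b) :
    Mem a x ∧ Mem b y := by
  obtain ⟨a', b', ha, hb, h⟩ := hf.2.1 _ (pairMem_iff.1 h)
  obtain ⟨rfl, rfl⟩ := pr_inj.1 (isOPair_iff.1 h)
  exact ⟨ha, hb⟩

/-- Bijections must be elements of the model; Separation inside a double power set turns a definable
correspondence between two sets into one. -/
theorem exists_isBij_of_rel {x y : M} (R : M → M → Prop)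
    [Dfn Set.univ (fun v : Fin 2 → M => R (v 0) (v 1))]
    (h₁ : ∀ a, Mem a x → ∃ b, Mem b y ∧ R a b) (h₂ : ∀ b, Mem b y → ∃ a, Mem a x ∧ R a b)
    (h₃ : ∀ a b c, Mem a x → Mem b y → Mem c y → R a b → R a c → b = c)
    (h₄ : ∀ a b c, Mem a y → Mem b x → Mem c x → R b a → R c a → b = c) :
    ∃ f : M, IsBij f x y ∧ ∀ a b, PairMem f a b ↔ Mem a x ∧ Mem b y ∧ R a b := by
  refine ⟨relSet x y R, ⟨isSet_compr _, ?_, ?_, ?_⟩, fun _ _ => pairMem_relSet⟩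
  · intro q hq
    obtain ⟨a, b, ha, hb, -, rfl⟩ := mem_relSet.1 hq
    exact ⟨a, b, ha, hb, isOPair_iff.2 rfl⟩
  · intro a ha
    obtain ⟨b, hb, hab⟩ := h₁ a ha
    exact ⟨b, pairMem_relSet.2 ⟨ha, hb, hab⟩, fun c hc =>
      h₃ a c b ha (pairMem_relSet.1 hc).2.1 hb (pairMem_relSet.1 hc).2.2 hab⟩
  · intro b hb
    obtain ⟨a, ha, hab⟩ := h₂ b hb
    exact ⟨a, pairMem_relSet.2 ⟨ha, hb, hab⟩, fun c hc =>
      h₄ b c a hb (pairMem_relSet.1 hc).1 ha (pairMem_relSet.1 hc).2.2 hab⟩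

theorem equinum_of_rel {x y : M} (hx : IsSet x) (hy : IsSet y) (R : M → M → Prop)
    [Dfn Set.univ (fun v : Fin 2 → M => R (v 0) (v 1))]
    (h₁ : ∀ a, Mem a x → ∃ b, Mem b y ∧ R a b) (h₂ : ∀ b, Mem b y → ∃ a, Mem a x ∧ R a b)
    (h₃ : ∀ a b c, Mem a x → Mem b y → Mem c y → R a b → R a c → b = c)
    (h₄ : ∀ a b c, Mem a y → Mem b x → Mem c x → R b a → R c a → b = c) : Equinum x y :=
  let ⟨f, hf, _⟩ := exists_isBij_of_rel R h₁ h₂ h₃ h₄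
  ⟨hx, hy, f, hf⟩

theorem equinum_of_fun {x y : M} (hx : IsSet x) (hy : IsSet y) (F : M → M)
    [DfnFun Set.univ (fun v : Fin 1 → M => F (v 0))]
    (h₁ : ∀ a, Mem a x → Mem (F a) y) (h₂ : ∀ b, Mem b y → ∃ a, Mem a x ∧ b = F a)
    (h₃ : ∀ a b, Mem a x → Mem b x → F a = F b → a = b) : Equinum x y := by
  have := fun {ι : Type} => @DfnFun.comp₁ M _ Set.univ ι F inferInstance
  exact equinum_of_rel hx hy (fun a b => b = F a) (fun a ha => ⟨F a, h₁ a ha, rfl⟩) h₂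
    (fun a b c _ _ _ hb hc => hb.trans hc.symm)
    (fun a b c _ hb hc h h' => h₃ b c hb hc (h.symm.trans h'))

theorem Equinum.refl {x : M} (hx : IsSet x) : Equinum x x :=
  equinum_of_rel hx hx (fun a b => a = b) (fun a ha => ⟨a, ha, rfl⟩) (fun a ha => ⟨a, ha, rfl⟩)
    (fun _ _ _ _ _ _ h h' => h.symm.trans h') (fun _ _ _ _ _ _ h h' => h.trans h'.symm)

theorem Equinum.symm {x y : M} (h : Equinum x y) : Equinum y x := by
  obtain ⟨hx, hy, f, hf⟩ := h
  refine equinum_of_rel hy hx (fun a b => PairMem f b a) ?_ ?_ ?_ ?_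
  · intro a ha
    obtain ⟨b, hb, -⟩ := hf.2.2.2 a ha
    exact ⟨b, (hf.mem_of_pairMem hb).1, hb⟩
  · intro a ha
    obtain ⟨b, hb, -⟩ := hf.2.2.1 a ha
    exact ⟨b, (hf.mem_of_pairMem hb).2, hb⟩
  · exact fun a b c ha _ _ h h' => (hf.2.2.2 a ha).unique h h'
  · exact fun a b c ha _ _ h h' => (hf.2.2.1 a ha).unique h h'

theorem Equinum.trans {x y z : M} (h : Equinum x y) (h' : Equinum y z) : Equinum x z := by
  obtain ⟨hx, hy, f, hf⟩ := h
  obtain ⟨-, hz, g, hg⟩ := h'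
  refine equinum_of_rel hx hz (fun a c => ∃ b, PairMem f a b ∧ PairMem g b c) ?_ ?_ ?_ ?_
  · intro a ha
    obtain ⟨b, hb, -⟩ := hf.2.2.1 a ha
    obtain ⟨c, hc, -⟩ := hg.2.2.1 b (hf.mem_of_pairMem hb).2
    exact ⟨c, (hg.mem_of_pairMem hc).2, b, hb, hc⟩
  · intro c hc
    obtain ⟨b, hb, -⟩ := hg.2.2.2 c hc
    obtain ⟨a, ha, -⟩ := hf.2.2.2 b (hg.mem_of_pairMem hb).1
    exact ⟨a, (hf.mem_of_pairMem ha).1, b, ha, hb⟩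
  · rintro a c c' ha _ _ ⟨b, hb, hc⟩ ⟨b', hb', hc'⟩
    obtain rfl := (hf.2.2.1 a ha).unique hb hb'
    exact (hg.2.2.1 b (hf.mem_of_pairMem hb).2).unique hc hc'
  · rintro c a a' h _ _ ⟨b, hb, hc⟩ ⟨b', hb', hc'⟩
    obtain rfl := (hg.2.2.2 c h).unique hc hc'
    exact (hf.2.2.2 b (hf.mem_of_pairMem hb).2).unique hb hb'

end Sets

/-! ### Induction and recursion along ω and along membership -/

section Recursion

variable {M : Type*} [lang.Structure M] {A : Set M} {ι : Type} [hM : Fact (IsModelZFUR M)]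

theorem not_mem_mem {x y : M} (h : Mem x y) : ¬ Mem y x := by
  intro h'
  obtain ⟨z, hz, hz'⟩ := hM.out.foundation (upair x y) ⟨x, mem_upair.2 (Or.inl rfl)⟩
  rcases mem_upair.1 hz with rfl | rfl
  · exact hz' y h' (mem_upair.2 (Or.inr rfl))
  · exact hz' x h (mem_upair.2 (Or.inl rfl))

/-- The successor `x ∪ {x}`. -/
noncomputable def succ (x : M) : M := union x (upair x x)

instance DfnFun.succ {t : (ι → M) → M} [DfnFun A t] : DfnFun A (fun v => succ (t v)) :=
  DfnFun.comp₁ (by unfold Urelement.succ; infer_instance)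

theorem mem_succ {x z : M} : Mem z (succ x) ↔ Mem z x ∨ z = x := by
  simp [succ, mem_union, mem_upair]

theorem succ_inj {x y : M} (h : succ x = succ y) : x = y := by
  have h₁ : Mem x (succ y) := h ▸ mem_succ.2 (Or.inr rfl)
  have h₂ : Mem y (succ x) := h ▸ mem_succ.2 (Or.inr rfl)
  rcases mem_succ.1 h₁ with h₁ | h₁
  · rcases mem_succ.1 h₂ with h₂ | h₂
    · exact absurd h₂ (not_mem_mem h₁)
    · exact h₂.symm
  · exact h₁

theorem succ_ne_emp (x : M) : succ x ≠ emp := fun h =>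
  not_mem_emp x (h ▸ mem_succ.2 (Or.inr rfl))

/-- The intersection of all inductive sets works: a definable property that is preserved by
successors cuts out an inductive set, which therefore contains the intersection. -/
theorem exists_omega : ∃ w : M, Mem emp w ∧ (∀ n, Mem n w → Mem (succ n) w) ∧
    ∀ P : M → Prop, Dfn Set.univ (fun v : Fin 1 → M => P (v 0)) → P emp →
      (∀ n, Mem n w → P n → P (succ n)) → ∀ n, Mem n w → P n := by
  obtain ⟨w, hw, ⟨e, hew, he, he'⟩, hs⟩ := hM.out.infinity
  obtain rfl := eq_emp he he'
  replace hs : ∀ n, Mem n w → Mem (succ n) w := fun n hn => by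
    obtain ⟨y, hy, hy', h⟩ := hs n hn
    have : y = succ n := ext_of_isSet hy' (isSet_union _ _) fun z => by rw [h, mem_succ]
    exact this ▸ hy
  have hmem := mem_compr (x := w) (P := fun n => ∀ w', Mem (emp : M) w' →
    (∀ k, Mem k w' → Mem (succ k) w') → Mem n w') fun z hz => hz w hew hs
  refine ⟨compr fun n => ∀ w', Mem (emp : M) w' → (∀ k, Mem k w' → Mem (succ k) w') → Mem n w',
    ?_, ?_, ?_⟩
  · exact (hmem _).2 fun w' h _ => h
  · exact fun n hn => (hmem _).2 fun w' h h' => h' n ((hmem _).1 hn w' h h')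
  · intro P hP h0 hS n hn
    have := fun {ι : Type} => @Dfn.comp₁ M _ Set.univ ι P hP
    have hmem' := mem_compr (P := fun z => Mem z w ∧ P z ∧ ∀ w', Mem (emp : M) w' →
      (∀ k, Mem k w' → Mem (succ k) w') → Mem z w') fun z hz => hz.1
    refine ((hmem' n).1 ((hmem n).1 hn _ ((hmem' _).2 ⟨hew, h0, fun w' h _ => h⟩) ?_)).2.1
    intro k hk
    obtain ⟨hk₁, hk₂, hk₃⟩ := (hmem' k).1 hk
    exact (hmem' _).2 ⟨hs k hk₁, hS k ((hmem k).2 hk₃) hk₂, fun w' h h' => h' k (hk₃ w' h h')⟩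

/-- Since `R` is functional on `K`, its iterates are definable from their number, and Replacement on
ω collects them; no dependent choice is involved. -/
theorem exists_orbit (R : M → M → Prop) [Dfn Set.univ (fun v : Fin 2 → M => R (v 0) (v 1))]
    (K : M → Prop) [Dfn Set.univ (fun v : Fin 1 → M => K (v 0))] {a : M} (ha : K a)
    (hR : ∀ x, K x → ∃! y, R x y) (hK : ∀ x y, K x → R x y → K y) :
    ∃ T : M, IsSet T ∧ Mem a T ∧ (∀ x, Mem x T → K x) ∧
      ∀ x, Mem x T → ∃ y, Mem y T ∧ R x y := by
  have := fun {ι : Type} => @Dfn.comp₁ M _ Set.univ ι K inferInstance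
  have := fun {ι : Type} => @Dfn.comp₂ M _ Set.univ ι R inferInstance
  obtain ⟨w, hw0, hwS, hind⟩ := exists_omega (M := M)
  -- A set `f` certifies the `n`-th iterate if each of its pairs is the initial one or is justified
  -- by a pair of `f` one step earlier. It need not be a function; uniqueness of the value follows
  -- by induction on `n`.
  let V : M → M → Prop := fun n y => ∃ f, PairMem f n y ∧ ∀ k z, PairMem f k z →
    k = emp ∧ z = a ∨ ∃ k' z', k = succ k' ∧ PairMem f k' z' ∧ R z' z
  have hV : Dfn Set.univ (fun v : Fin 2 → M => V (v 0) (v 1)) := by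
    unfold V; infer_instance
  have := fun {ι : Type} => @Dfn.comp₂ M _ Set.univ ι V hV
  have hV₀ : V emp a := by
    refine ⟨upair (pr emp a) (pr emp a), ?_, ?_⟩
    · simp [pairMem_iff, mem_upair]
    · intro k z
      simp only [pairMem_iff, mem_upair, or_self, pr_inj]
      exact Or.inl
  have hVS : ∀ n y z, V n y → R y z → V (succ n) z := by
    rintro n y z ⟨f, hf, hf'⟩ hyz
    refine ⟨union f (upair (pr (succ n) z) (pr (succ n) z)), ?_, ?_⟩
    · simp [pairMem_iff, mem_union, mem_upair]
    · intro k u hk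
      simp only [pairMem_iff, mem_union, mem_upair, or_self, pr_inj] at hf hf' hk ⊢
      rcases hk with hk | ⟨rfl, rfl⟩
      · rcases hf' k u hk with h | ⟨k', z', h, h', h''⟩
        · exact Or.inl h
        · exact Or.inr ⟨k', z', h, Or.inl h', h''⟩
      · exact Or.inr ⟨n, y, rfl, Or.inl hf, hyz⟩
  have hV₀' : ∀ y, V emp y → y = a := by
    rintro y ⟨f, hf, hf'⟩
    rcases hf' _ _ hf with h | ⟨k', z', h, -⟩
    · exact h.2
    · exact absurd h.symm (succ_ne_emp _)
  have hVS' : ∀ n z, V (succ n) z → ∃ y, V n y ∧ R y z := by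
    rintro n z ⟨f, hf, hf'⟩
    rcases hf' _ _ hf with h | ⟨k', z', h, h', h''⟩
    · exact absurd h.1 (succ_ne_emp _)
    · obtain rfl := succ_inj h
      exact ⟨z', ⟨f, h', hf'⟩, h''⟩
  have key : ∀ n, Mem n w → ∃ y, K y ∧ V n y ∧ ∀ z, V n z → z = y := by
    refine hind (fun n => ∃ y, K y ∧ V n y ∧ ∀ z, V n z → z = y) inferInstance
      ⟨a, ha, hV₀, hV₀'⟩ ?_
    rintro n - ⟨y, hy, hn, hu⟩
    obtain ⟨z, hz, hz'⟩ := hR y hy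
    refine ⟨z, hK y z hy hz, hVS n y z hn hz, fun u hnu => ?_⟩
    obtain ⟨y', hy', hu'⟩ := hVS' n u hnu
    obtain rfl := hu y' hy'
    exact hz' u hu'
  obtain ⟨T, hT, hmem⟩ := exists_replacement V w fun n hn =>
    let ⟨y, _, h, h'⟩ := key n hn
    ⟨y, h, h'⟩
  refine ⟨T, hT, (hmem a).2 ⟨emp, hw0, hV₀⟩, fun x hx => ?_, fun x hx => ?_⟩
  · obtain ⟨n, hn, hx⟩ := (hmem x).1 hx
    obtain ⟨y, hy, -, hu⟩ := key n hn
    exact hu x hx ▸ hy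
  · obtain ⟨n, hn, hx⟩ := (hmem x).1 hx
    obtain ⟨y, hy, -, hu⟩ := key n hn
    obtain ⟨z, hz, -⟩ := hR y hy
    exact ⟨z, (hmem z).2 ⟨succ n, hwS n hn, hVS n x z hx (hu x hx ▸ hz)⟩, hu x hx ▸ hz⟩

theorem exists_isTransSet (x : M) : ∃ t : M, IsTransSet t ∧ Mem x t := by
  obtain ⟨T, -, hx, -, hT⟩ := exists_orbit (fun a b : M => b = sUnion a) (fun _ => True)
    (a := upair x x) trivial (fun a _ => ⟨_, rfl, fun _ h => h⟩) (fun _ _ _ _ => trivial)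
  refine ⟨sUnion T, ⟨isSet_compr _, fun y hy z hz => ?_⟩, ?_⟩
  · obtain ⟨a, ha, hy⟩ := mem_sUnion.1 hy
    obtain ⟨b, hb, rfl⟩ := hT a ha
    exact mem_sUnion.2 ⟨_, hb, mem_sUnion.2 ⟨y, hy, hz⟩⟩
  · exact mem_sUnion.2 ⟨_, hx, mem_upair.2 (Or.inl rfl)⟩

/-- The transitive closure of `{x}`. -/
noncomputable def tc (x : M) : M := compr fun y => ∀ t, IsTransSet t → Mem x t → Mem y t

instance DfnFun.tc {t : (ι → M) → M} [DfnFun A t] : DfnFun A (fun v => tc (t v)) :=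
  DfnFun.comp₁ (by unfold Urelement.tc; infer_instance)

theorem mem_tc {x y : M} : Mem y (tc x) ↔ ∀ t, IsTransSet t → Mem x t → Mem y t := by
  obtain ⟨t, ht, hx⟩ := exists_isTransSet x
  exact mem_compr (P := fun y => ∀ t, IsTransSet t → Mem x t → Mem y t) (fun y hy => hy t ht hx) y

theorem mem_tc_self (x : M) : Mem x (tc x) := mem_tc.2 fun _ _ h => h

theorem isTransSet_tc (x : M) : IsTransSet (tc x) :=
  ⟨isSet_compr _, fun y hy z hz => mem_tc.2 fun t ht hx => ht.2 y (mem_tc.1 hy t ht hx) z hz⟩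

theorem mem_tc_of_mem {x y : M} (h : Mem y x) : Mem y (tc x) :=
  (isTransSet_tc x).2 x (mem_tc_self x) y h

theorem mem_tc_iff {x y : M} : Mem y (tc x) ↔ y = x ∨ ∃ z, Mem z x ∧ Mem y (tc z) := by
  constructor
  · intro h
    have hmem := mem_compr (P := fun y => y = x ∨ ∃ z, Mem z x ∧ Mem y (tc z)) (x := tc x) (by
      rintro y (rfl | ⟨z, hz, hy⟩)
      · exact mem_tc_self _
      · exact mem_tc.1 hy _ (isTransSet_tc x) (mem_tc_of_mem hz))
    refine (hmem y).1 (mem_tc.1 h _ ⟨isSet_compr _, fun u hu v hv => ?_⟩ ((hmem x).2 (Or.inl rfl)))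
    rcases (hmem u).1 hu with rfl | ⟨z, hz, hu⟩
    · exact (hmem v).2 (Or.inr ⟨v, hv, mem_tc_self v⟩)
    · exact (hmem v).2 (Or.inr ⟨z, hz, (isTransSet_tc z).2 u hu v hv⟩)
  · rintro (rfl | ⟨z, hz, hy⟩)
    · exact mem_tc_self _
    · exact mem_tc.1 hy _ (isTransSet_tc x) (mem_tc_of_mem hz)

/-- Membership induction for definable classes. -/
theorem mem_induction {P : M → Prop} [hP : Dfn Set.univ (fun v : Fin 1 → M => P (v 0))]
    (h : ∀ x, (∀ y, Mem y x → P y) → P x) (x : M) : P x := by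
  have := fun {ι : Type} => @Dfn.comp₁ M _ Set.univ ι P inferInstance
  by_contra hx
  have hmem := mem_compr (P := fun y => Mem y (tc x) ∧ ¬ P y) (fun _ h => h.1)
  obtain ⟨y, hy, hy'⟩ := hM.out.foundation _ ⟨x, (hmem x).2 ⟨mem_tc_self x, hx⟩⟩
  obtain ⟨hy₁, hy₂⟩ := (hmem y).1 hy
  refine hy₂ (h y fun z hz => ?_)
  by_contra hz'
  exact hy' z hz ((hmem z).2 ⟨(isTransSet_tc x).2 y hy₁ z hz, hz'⟩)

/-- The pair `(a, b)` belongs to a set of pairs that satisfy `P` which has the forth property and,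
if `β` holds, the back property. -/
def Sim (P : M → M → Prop) (β : Prop) (a b : M) : Prop :=
  ∃ S : M, PairMem S a b ∧ ∀ x y, PairMem S x y → P x y ∧
    (∀ x', Mem x' x → ∃ y', Mem y' y ∧ PairMem S x' y') ∧
    (β → ∀ y', Mem y' y → ∃ x', Mem x' x ∧ PairMem S x' y')

instance Dfn.sim {P : M → M → Prop} {β : Prop} [hP : Dfn A (fun v : Fin 2 → M => P (v 0) (v 1))]
    {t s : (ι → M) → M} [DfnFun A t] [DfnFun A s] : Dfn A (fun v => Sim P β (t v) (s v)) := by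
  have := fun {ι : Type} => @Dfn.comp₂ M _ A ι P hP
  exact Dfn.comp₂ (by unfold Sim; infer_instance)

/-- The union of all certifying sets satisfies the recursion equation: the relation itself, with
`(a, b)` added and restricted to the two transitive closures, is again a certifying set. Rank
comparison and the action of permutations of urelements are both instances. -/
theorem sim_iff {P : M → M → Prop} [hP : Dfn Set.univ (fun v : Fin 2 → M => P (v 0) (v 1))]
    {β : Prop} {a b : M} : Sim P β a b ↔ P a b ∧
      (∀ x, Mem x a → ∃ y, Mem y b ∧ Sim P β x y) ∧
      (β → ∀ y, Mem y b → ∃ x, Mem x a ∧ Sim P β x y) := by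
  have := fun {ι : Type} => @Dfn.comp₂ M _ Set.univ ι P hP
  have forth : ∀ {a b}, Sim P β a b → P a b ∧ (∀ x, Mem x a → ∃ y, Mem y b ∧ Sim P β x y) ∧
      (β → ∀ y, Mem y b → ∃ x, Mem x a ∧ Sim P β x y) := by
    rintro a b ⟨S, hab, hS⟩
    refine ⟨(hS a b hab).1, fun x hx => ?_, fun hβ y hy => ?_⟩
    · obtain ⟨y, hy, h⟩ := (hS a b hab).2.1 x hx
      exact ⟨y, hy, S, h, hS⟩
    · obtain ⟨x, hx, h⟩ := (hS a b hab).2.2 hβ y hy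
      exact ⟨x, hx, S, h, hS⟩
  refine ⟨forth, fun ⟨h₁, h₂, h₃⟩ => ?_⟩
  let R : M → M → Prop := fun x y => x = a ∧ y = b ∨ Sim P β x y
  have hR : Dfn Set.univ (fun v : Fin 2 → M => R (v 0) (v 1)) := by unfold R; infer_instance
  refine ⟨relSet (tc a) (tc b) R,
    pairMem_relSet.2 ⟨mem_tc_self a, mem_tc_self b, Or.inl ⟨rfl, rfl⟩⟩, fun x y hxy => ?_⟩
  obtain ⟨hx, hy, h⟩ := pairMem_relSet.1 hxy
  have h' : P x y ∧ (∀ u, Mem u x → ∃ v, Mem v y ∧ Sim P β u v) ∧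
      (β → ∀ v, Mem v y → ∃ u, Mem u x ∧ Sim P β u v) := by
    rcases h with ⟨rfl, rfl⟩ | h
    · exact ⟨h₁, h₂, h₃⟩
    · exact forth h
  refine ⟨h'.1, fun u hu => ?_, fun hβ v hv => ?_⟩
  · obtain ⟨v, hv, huv⟩ := h'.2.1 u hu
    exact ⟨v, hv, pairMem_relSet.2
      ⟨(isTransSet_tc a).2 x hx u hu, (isTransSet_tc b).2 y hy v hv, Or.inr huv⟩⟩
  · obtain ⟨u, hu, huv⟩ := h'.2.2 hβ v hv
    exact ⟨u, hu, pairMem_relSet.2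
      ⟨(isTransSet_tc a).2 x hx u hu, (isTransSet_tc b).2 y hy v hv, Or.inr huv⟩⟩

end Recursion

/-! ### Rank comparison without ordinals, and the hierarchy over a set of urelements -/

section Rank

variable {M : Type*} [lang.Structure M] {A : Set M} {ι : Type} [hM : Fact (IsModelZFUR M)]

/-- The rank of `a` is at most that of `b`, where urelements have the rank of the empty set. -/
def RankLE (a b : M) : Prop := Sim (fun _ _ => True) False a b

instance Dfn.rankLE {t s : (ι → M) → M} [DfnFun A t] [DfnFun A s] :
    Dfn A (fun v => RankLE (t v) (s v)) :=
  Dfn.comp₂ (by unfold RankLE; infer_instance)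

theorem rankLE_iff {a b : M} : RankLE a b ↔ ∀ x, Mem x a → ∃ y, Mem y b ∧ RankLE x y := by
  rw [RankLE, sim_iff]
  simp [RankLE]

theorem RankLE.refl (a : M) : RankLE a a :=
  mem_induction (P := fun a : M => RankLE a a)
    (fun _ h => rankLE_iff.2 fun y hy => ⟨y, hy, h y hy⟩) a

theorem RankLE.trans {a b c : M} (h : RankLE a b) (h' : RankLE b c) : RankLE a c := by
  refine mem_induction (P := fun a : M => ∀ b c, RankLE a b → RankLE b c → RankLE a c)
    (fun a ih b c h h' => rankLE_iff.2 fun x hx => ?_) a b c h h'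
  obtain ⟨y, hy, hxy⟩ := rankLE_iff.1 h x hx
  obtain ⟨z, hz, hyz⟩ := rankLE_iff.1 h' y hy
  exact ⟨z, hz, ih x hx y z hxy hyz⟩

theorem rankLE_of_sub {a b : M} (h : Sub a b) : RankLE a b :=
  rankLE_iff.2 fun x hx => ⟨x, h x hx, .refl x⟩

theorem rankLE_of_mem {a b : M} (h : Mem a b) : RankLE a b := by
  refine mem_induction (P := fun a : M => ∀ b, Mem a b → RankLE a b)
    (fun a ih b h => rankLE_iff.2 fun x hx => ⟨a, h, ih x hx a hx⟩) a b h

theorem rankLE_or_lt (a b : M) : RankLE a b ∨ ∃ a', Mem a' a ∧ RankLE b a' := by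
  refine mem_induction (P := fun a : M => ∀ b, RankLE a b ∨ ∃ a', Mem a' a ∧ RankLE b a')
    (fun a ih b => ?_) a b
  by_contra! h
  refine h.1 (rankLE_iff.2 fun x hx => ?_)
  by_contra! hx'
  refine h.2 x hx (rankLE_iff.2 fun y hy => ?_)
  exact (ih x hx y).resolve_left (hx' y hy)

theorem rankLE_total (a b : M) : RankLE a b ∨ RankLE b a :=
  (rankLE_or_lt a b).imp_right fun ⟨_, ha, hb⟩ => hb.trans (rankLE_of_mem ha)

theorem not_rankLE_of_mem {a b : M} (h : Mem a b) : ¬ RankLE b a := by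
  refine mem_induction (P := fun a : M => ∀ b, Mem a b → ¬ RankLE b a)
    (fun a ih b h h' => ?_) a b h
  obtain ⟨x, hx, hax⟩ := rankLE_iff.1 h' a h
  exact ih x hx a hx hax

/-- Otherwise every element of `Q` has another of strictly smaller rank; membership induction on an
upper bound `x` of the ranks rules this out. -/
theorem exists_rankLE_least (Q : M → Prop) [Dfn Set.univ (fun v : Fin 1 → M => Q (v 0))]
    (hQ : ∃ q, Q q) : ∃ q, Q q ∧ ∀ q', Q q' → RankLE q q' := by
  have := fun {ι : Type} => @Dfn.comp₁ M _ Set.univ ι Q inferInstance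
  by_contra! h
  obtain ⟨q, hq⟩ := hQ
  refine mem_induction (P := fun x : M => ∀ q, RankLE q x → ¬ Q q)
    (fun x ih q hqx hq => ?_) q q (.refl q) hq
  obtain ⟨q', hq', hqq'⟩ := h q hq
  obtain ⟨u, hu, hq'u⟩ := (rankLE_or_lt q q').resolve_left hqq'
  obtain ⟨x', hx', hux'⟩ := rankLE_iff.1 hqx u hu
  exact ih x' hx' q' (hq'u.trans hux') hq'

/-- All the urelements in the transitive closure of `{y}` are members of `X`. -/
def Over (X y : M) : Prop := ∀ a, IsUr a → Mem a (tc y) → Mem a X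

instance Dfn.over {t s : (ι → M) → M} [DfnFun A t] [DfnFun A s] :
    Dfn A (fun v => Over (t v) (s v)) :=
  Dfn.comp₂ (by unfold Over; infer_instance)

theorem over_iff {X y : M} : Over X y ↔ (IsUr y → Mem y X) ∧ ∀ z, Mem z y → Over X z := by
  constructor
  · exact fun h => ⟨fun hy => h y hy (mem_tc_self y), fun z hz a ha haz =>
      h a ha (mem_tc_iff.2 (Or.inr ⟨z, hz, haz⟩))⟩
  · rintro ⟨h, h'⟩ a ha hay
    rcases mem_tc_iff.1 hay with rfl | ⟨z, hz, haz⟩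
    · exact h ha
    · exact h' z hz a ha haz

theorem Over.mono {X Y y : M} (h : Over X y) (hXY : Sub X Y) : Over Y y :=
  fun a ha hay => hXY a (h a ha hay)

theorem Over.mem {X y z : M} (h : Over X y) (hz : Mem z y) : Over X z := (over_iff.1 h).2 z hz

theorem over_of_isSet {X y : M} (hy : IsSet y) (h : ∀ z, Mem z y → Over X z) : Over X y :=
  over_iff.2 ⟨fun hy' => absurd hy' hy, h⟩

theorem over_of_mem {X a : M} (ha : IsUr a) (haX : Mem a X) : Over X a :=
  over_iff.2 ⟨fun _ => haX, fun _ hz => absurd ha (isSet_of_mem hz)⟩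

theorem IsSetOfUr.over {X Y : M} (hX : IsSetOfUr X) (h : Sub X Y) : Over Y X :=
  over_of_isSet hX.1 fun z hz => over_of_mem (hX.2 z hz) (h z hz)

theorem over_upair {X a b : M} (ha : Over X a) (hb : Over X b) : Over X (upair a b) :=
  over_of_isSet (isSet_upair a b) fun z hz => by
    rcases mem_upair.1 hz with rfl | rfl <;> assumption

theorem over_pr {X a b : M} (ha : Over X a) (hb : Over X b) : Over X (pr a b) :=
  over_upair (over_upair ha ha) (over_upair ha hb)

/-- The level with index `r` of the cumulative hierarchy over the urelements in `X`. -/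
noncomputable def level (r X : M) : M := compr fun y => RankLE y r ∧ Over X y

instance DfnFun.level {t s : (ι → M) → M} [DfnFun A t] [DfnFun A s] :
    DfnFun A (fun v => level (t v) (s v)) :=
  DfnFun.comp₂ (by unfold Urelement.level; infer_instance)

theorem isSet_level (r X : M) : IsSet (level r X) := isSet_compr _

/-- The point is that the level exists as a set. By induction on `r`: its elements are members of
`X` or subsets of the union of the levels with indices in `r`, which Replacement collects. -/
theorem mem_level {r X y : M} : Mem y (level r X) ↔ RankLE y r ∧ Over X y := by
  refine mem_induction (P := fun r : M => ∀ y, Mem y (level r X) ↔ RankLE y r ∧ Over X y)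
    (fun r ih y => ?_) r y
  obtain ⟨W, -, hW⟩ := exists_replacement (fun r' v : M => v = level r' X) r
    fun r' _ => ⟨_, rfl, fun _ h => h⟩
  refine mem_compr (P := fun y => RankLE y r ∧ Over X y) (x := union X (power (sUnion W))) ?_ y
  rintro y ⟨hy, hX⟩
  rw [mem_union]
  by_cases hur : IsUr y
  · exact Or.inl ((over_iff.1 hX).1 hur)
  · refine Or.inr (mem_power.2 ⟨hur, fun z hz => ?_⟩)
    obtain ⟨r', hr', hzr'⟩ := rankLE_iff.1 hy z hz
    exact mem_sUnion.2 ⟨_, (hW _).2 ⟨r', hr', rfl⟩, (ih r' hr' z).2 ⟨hzr', hX.mem hz⟩⟩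

theorem over_level (r X : M) : Over X (level r X) :=
  over_of_isSet (isSet_level r X) fun _ h => (mem_level.1 h).2

theorem level_sub_level {r s X Y : M} (hrs : RankLE r s) (hXY : Sub X Y) :
    Sub (level r X) (level s Y) := fun y hy => by
  rw [mem_level] at hy ⊢
  exact ⟨hy.1.trans hrs, hy.2.mono hXY⟩

theorem rankLE_level {r X : M} (h : Over X r) : RankLE r (level r X) :=
  rankLE_of_sub fun _ hx => mem_level.2 ⟨rankLE_of_mem hx, h.mem hx⟩

end Rank

/-! ### Automorphisms induced by permuting urelements -/

section Automorphism

variable {M : Type*} [lang.Structure M]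

/-- `x` and `y` have no common member. -/
def Disj (x y : M) : Prop := ∀ z, Mem z x → ¬ Mem z y

instance Dfn.disj {A : Set M} {ι : Type} {t s : (ι → M) → M} [DfnFun A t] [DfnFun A s] :
    Dfn A (fun v => Disj (t v) (s v)) :=
  Dfn.comp₂ (by unfold Disj; infer_instance)

theorem Disj.symm {x y : M} (h : Disj x y) : Disj y x := fun z hy hx => h z hx hy

theorem isUr_map (σ : M ≃[lang] M) (x : M) : IsUr (σ x) ↔ IsUr x := by
  rw [IsUr, IsUr, ← StrongHomClass.map_rel σ (Symb.ure : lang.Relations 1) ![x] ]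
  refine iff_of_eq (congrArg _ ?_)
  ext i
  fin_cases i
  rfl

theorem mem_map (σ : M ≃[lang] M) (x y : M) : Mem (σ x) (σ y) ↔ Mem x y := by
  rw [Mem, Mem, ← StrongHomClass.map_rel σ (Symb.mem : lang.Relations 2) ![x, y] ]
  refine iff_of_eq (congrArg _ ?_)
  ext i
  fin_cases i <;> rfl

theorem mem_map_iff_exists (σ : M ≃[lang] M) {x z : M} :
    Mem z (σ x) ↔ ∃ y, Mem y x ∧ z = σ y := by
  constructor
  · intro h
    obtain ⟨y, rfl⟩ := σ.surjective z
    exact ⟨y, (mem_map σ y x).1 h, rfl⟩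
  · rintro ⟨y, hy, rfl⟩
    exact (mem_map σ y x).2 hy

variable [hM : Fact (IsModelZFUR M)]

/-- A definable involution of the urelements extends to an automorphism. -/
theorem exists_automorphism (T : M → M → Prop)
    [hT : Dfn Set.univ (fun v : Fin 2 → M => T (v 0) (v 1))] (symm : ∀ a b, T a b → T b a)
    (total : ∀ a, IsUr a → ∃ b, IsUr b ∧ T a b) (unique : ∀ a b c, T a b → T a c → b = c) :
    ∃ σ : M ≃[lang] M, (∀ a b, IsUr a → IsUr b → T a b → σ a = b) ∧
      (∀ X, (∀ a, IsUr a → Mem a X → T a a) → ∀ y, Over X y → σ y = y) ∧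
      ∀ y, IsSet y → Equinum y (σ y) := by
  have := fun {ι : Type} => @Dfn.comp₂ M _ Set.univ ι T hT
  -- The hereditary extension of `T`, which relates sets whose members correspond back and forth.
  let S : M → M → Prop := Sim (fun a b => (IsUr a ↔ IsUr b) ∧ (IsUr a → T a b)) True
  have hS : Dfn Set.univ (fun v : Fin 2 → M => S (v 0) (v 1)) := by unfold S; infer_instance
  have := fun {ι : Type} => @Dfn.comp₂ M _ Set.univ ι S hS
  have S_iff : ∀ {a b}, S a b ↔ ((IsUr a ↔ IsUr b) ∧ (IsUr a → T a b)) ∧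
      (∀ x, Mem x a → ∃ y, Mem y b ∧ S x y) ∧ (∀ y, Mem y b → ∃ x, Mem x a ∧ S x y) := by
    intro a b
    unfold S
    rw [sim_iff]
    simp
  have S_ur : ∀ {a b}, IsUr a → IsUr b → T a b → S a b := fun ha hb hab => S_iff.2
    ⟨⟨iff_of_true ha hb, fun _ => hab⟩, fun x hx => absurd ha (isSet_of_mem hx),
      fun x hx => absurd hb (isSet_of_mem hx)⟩
  have S_unique : ∀ x y z, S x y → S x z → y = z := by
    refine mem_induction (P := fun x : M => ∀ y z, S x y → S x z → y = z) fun x ih y z hy hz => ?_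
    obtain ⟨⟨hy₁, hy₂⟩, hy₃, hy₄⟩ := S_iff.1 hy
    obtain ⟨⟨hz₁, hz₂⟩, hz₃, hz₄⟩ := S_iff.1 hz
    by_cases hx : IsUr x
    · exact unique x y z (hy₂ hx) (hz₂ hx)
    · refine ext_of_isSet (fun h => hx (hy₁.2 h)) (fun h => hx (hz₁.2 h)) fun u => ⟨fun hu => ?_,
        fun hu => ?_⟩
      · obtain ⟨w, hw, hwu⟩ := hy₄ u hu
        obtain ⟨u', hu', hwu'⟩ := hz₃ w hw
        exact ih w hw u u' hwu hwu' ▸ hu'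
      · obtain ⟨w, hw, hwu⟩ := hz₄ u hu
        obtain ⟨u', hu', hwu'⟩ := hy₃ w hw
        exact ih w hw u u' hwu hwu' ▸ hu'
  have S_total : ∀ x, ∃ y, S x y := by
    refine mem_induction (P := fun x : M => ∃ y, S x y) fun x ih => ?_
    by_cases hx : IsUr x
    · obtain ⟨b, hb, hab⟩ := total x hx
      exact ⟨b, S_ur hx hb hab⟩
    -- The image of a set is the set of images of its members, provided by Replacement because `S`
    -- is single-valued.
    · obtain ⟨v, hv, hv'⟩ := exists_replacement S x fun u hu =>
        let ⟨y, hy⟩ := ih u hu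
        ⟨y, hy, fun z hz => S_unique u z y hz hy⟩
      refine ⟨v, S_iff.2 ⟨⟨iff_of_false hx hv, fun h => absurd h hx⟩, fun u hu => ?_,
        fun y hy => (hv' y).1 hy⟩⟩
      obtain ⟨y, hy⟩ := ih u hu
      exact ⟨y, (hv' y).2 ⟨u, hu, hy⟩, hy⟩
  have S_symm : ∀ x y, S x y → S y x := by
    refine mem_induction (P := fun x : M => ∀ y, S x y → S y x) fun x ih y hxy => ?_
    obtain ⟨⟨h₁, h₂⟩, h₃, h₄⟩ := S_iff.1 hxy
    refine S_iff.2 ⟨⟨h₁.symm, fun h => symm _ _ (h₂ (h₁.2 h))⟩, fun v hv => ?_, fun u hu => ?_⟩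
    · obtain ⟨u, hu, huv⟩ := h₄ v hv
      exact ⟨u, hu, ih u hu v huv⟩
    · obtain ⟨v, hv, huv⟩ := h₃ u hu
      exact ⟨v, hv, ih u hu v huv⟩
  choose σ hσ using S_total
  have S_iff_eq : ∀ {x y}, S x y ↔ y = σ x := fun {x y} =>
    ⟨fun h => S_unique x y _ h (hσ x), fun h => h ▸ hσ x⟩
  have hσσ : ∀ x, σ (σ x) = x := fun x => (S_iff_eq.1 (S_symm _ _ (hσ x))).symm
  have hmem : ∀ {x y}, Mem x y → Mem (σ x) (σ y) := fun {x y} h => by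
    obtain ⟨z, hz, hxz⟩ := (S_iff.1 (hσ y)).2.1 x h
    exact S_iff_eq.1 hxz ▸ hz
  let τ : M ≃[lang] M :=
    { toFun := σ
      invFun := σ
      left_inv := hσσ
      right_inv := hσσ
      map_fun' := fun f => nomatch f
      map_rel' := by
        intro n R x
        cases R with
        | ure =>
          have h : ∀ y : Fin 1 → M, Structure.RelMap (L := lang) (Symb.ure : lang.Relations 1) y ↔
              IsUr (y 0) := fun y => by rw [IsUr, ← FinVec.etaExpand_eq y]; rfl
          exact (h _).trans ((S_iff.1 (hσ (x 0))).1.1.symm.trans (h _).symm)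
        | mem =>
          have h : ∀ y : Fin 2 → M, Structure.RelMap (L := lang) (Symb.mem : lang.Relations 2) y ↔
              Mem (y 0) (y 1) := fun y => by rw [Mem, ← FinVec.etaExpand_eq y]; rfl
          refine (h _).trans (Iff.trans ⟨fun h => ?_, hmem⟩ (h _).symm)
          have := hmem h
          simpa [hσσ] using this }
  refine ⟨τ, fun a b ha hb hab => (S_iff_eq.1 (S_ur ha hb hab)).symm, fun X hX y hy => ?_,
    fun y hy => ?_⟩
  · suffices S y y from (S_iff_eq.1 this).symm
    refine mem_induction (P := fun y : M => Over X y → S y y) (fun y ih hy => ?_) y hy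
    refine S_iff.2 ⟨⟨Iff.rfl, fun h => hX y h ((over_iff.1 hy).1 h)⟩, fun x hx => ?_,
      fun x hx => ?_⟩ <;> exact ⟨x, hx, ih x hx (hy.mem hx)⟩
  -- The automorphism has the definable graph `S`, so its restriction to the set `y` is a bijection
  -- inside the model.
  · refine equinum_of_rel hy (fun h => hy ((isUr_map τ y).1 h)) S (fun a ha => ?_) (fun b hb => ?_)
      (fun a b c _ _ _ => S_unique a b c)
      (fun a b c _ _ _ hb hc => S_unique a b c (S_symm _ _ hb) (S_symm _ _ hc))
    · exact ⟨σ a, hmem ha, hσ a⟩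
    · obtain ⟨a, ha, rfl⟩ := (mem_map_iff_exists τ).1 hb
      exact ⟨a, ha, hσ a⟩

/-- Exchange `C` and `D` along a bijection and leave other urelements alone; disjointness makes this
a well-defined involution. -/
theorem exists_automorphism_swap {C D : M} (hC : IsSetOfUr C) (hD : IsSetOfUr D)
    (hCD : Disj C D) (h : Equinum C D) : ∃ σ : M ≃[lang] M, σ C = D ∧
      (∀ X, Disj C X → Disj D X → ∀ y, Over X y → σ y = y) ∧
      ∀ y, IsSet y → Equinum y (σ y) := by
  obtain ⟨-, -, f, hf⟩ := h
  have hCf : ∀ {a b}, PairMem f a b → Mem a C := fun h => (hf.mem_of_pairMem h).1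
  have hDf : ∀ {a b}, PairMem f a b → Mem b D := fun h => (hf.mem_of_pairMem h).2
  have u₁ : ∀ {a b c}, PairMem f a b → PairMem f a c → b = c := fun h h' =>
    (hf.2.2.1 _ (hCf h)).unique h h'
  have u₂ : ∀ {a b c}, PairMem f b a → PairMem f c a → b = c := fun h h' =>
    (hf.2.2.2 _ (hDf h)).unique h h'
  let T : M → M → Prop := fun a b => PairMem f a b ∨ PairMem f b a ∨ a = b ∧ ¬ Mem a C ∧ ¬ Mem a D
  have hT : Dfn Set.univ (fun v : Fin 2 → M => T (v 0) (v 1)) := by unfold T; infer_instance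
  have T_symm : ∀ a b, T a b → T b a := by
    rintro a b (h | h | ⟨rfl, h⟩)
    · exact Or.inr (Or.inl h)
    · exact Or.inl h
    · exact Or.inr (Or.inr ⟨rfl, h⟩)
  have T_total : ∀ a, IsUr a → ∃ b, IsUr b ∧ T a b := by
    intro a ha
    by_cases haC : Mem a C
    · obtain ⟨b, hb, -⟩ := hf.2.2.1 a haC
      exact ⟨b, hD.2 b (hDf hb), Or.inl hb⟩
    by_cases haD : Mem a D
    · obtain ⟨b, hb, -⟩ := hf.2.2.2 a haD
      exact ⟨b, hC.2 b (hCf hb), Or.inr (Or.inl hb)⟩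
    · exact ⟨a, ha, Or.inr (Or.inr ⟨rfl, haC, haD⟩)⟩
  have T_unique : ∀ a b c, T a b → T a c → b = c := by
    rintro a b c (h | h | ⟨rfl, h⟩) (h' | h' | ⟨rfl, h'⟩)
    · exact u₁ h h'
    · exact absurd (hDf h') (hCD a (hCf h))
    · exact absurd (hCf h) h'.1
    · exact absurd (hDf h) (hCD a (hCf h'))
    · exact u₂ h h'
    · exact absurd (hDf h) h'.2
    · exact absurd (hCf h') h.1
    · exact absurd (hDf h') h.2
    · rfl
  obtain ⟨σ, hσ, hσX, hσE⟩ := exists_automorphism T T_symm T_total T_unique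
  refine ⟨σ, ?_, fun X hCX hDX y hy => hσX X ?_ y hy, hσE⟩
  · refine ext_of_isSet (fun h => hC.1 ((isUr_map σ C).1 h)) hD.1 fun z => ?_
    rw [mem_map_iff_exists]
    constructor
    · rintro ⟨y, hy, rfl⟩
      obtain ⟨b, hb, -⟩ := hf.2.2.1 y hy
      rw [hσ y b (hC.2 y hy) (hD.2 b (hDf hb)) (Or.inl hb)]
      exact hDf hb
    · intro hz
      obtain ⟨y, hy, -⟩ := hf.2.2.2 z hz
      exact ⟨y, hCf hy, (hσ y z (hC.2 y (hCf hy)) (hD.2 z hz) (Or.inl hy)).symm⟩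
  · exact fun a _ haX => Or.inr (Or.inr ⟨rfl, fun h => hCX a h haX, fun h => hDX a h haX⟩)

end Automorphism

/-! ### Fresh copies, homogeneity, and the urelements involved in cardinals -/

section Plenitude

variable {M : Type*} [lang.Structure M] {A : Set M} {ι : Type} [hM : Fact (IsModelZFUR M)]

/-- Under Plenitude⁺, every set has a copy consisting of urelements outside of a given `E`. -/
theorem exists_disjoint_copy (hplen : PlenitudePlus M) {x : M} (hx : IsSet x) (E : M) :
    ∃ D, IsSetOfUr D ∧ Disj D E ∧ Equinum x D := by
  -- Each `a` in `x` receives as many urelements as `E` has subsets, so by Cantor's argument at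
  -- least one lies outside `E`. The diagonal set `d a` selects it definably: `g (d a, a)` cannot
  -- belong to `E`.
  obtain ⟨G, hG, -, -, g, hg⟩ := hplen (relSet (power E) x fun _ _ => True) (isSet_compr _)
  let d : M → M := fun a => compr fun e => Mem e E ∧ ∃ h, PairMem g (pr h a) e ∧ ¬ Mem e h
  have hd : DfnFun Set.univ (fun v : Fin 1 → M => d (v 0)) := by unfold d; infer_instance
  have := fun {ι : Type} => @DfnFun.comp₁ M _ Set.univ ι d hd
  have mem_d : ∀ a e, Mem e (d a) ↔ Mem e E ∧ ∃ h, PairMem g (pr h a) e ∧ ¬ Mem e h := fun a =>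
    mem_compr (P := fun e : M => Mem e E ∧ ∃ h, PairMem g (pr h a) e ∧ ¬ Mem e h) fun _ h => h.1
  have g_inj : ∀ {h a h' a' u}, PairMem g (pr h a) u → PairMem g (pr h' a') u → h = h' ∧ a = a' :=
    fun hu hu' => pr_inj.1 ((hg.2.2.2 _ (hg.mem_of_pairMem hu).2).unique hu hu')
  have mem_D := mem_compr (P := fun u : M => ∃ a, Mem a x ∧ PairMem g (pr (d a) a) u) (x := G)
    fun u ⟨a, _, h⟩ => (hg.mem_of_pairMem h).2
  refine ⟨compr fun u => ∃ a, Mem a x ∧ PairMem g (pr (d a) a) u,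
    ⟨isSet_compr _, fun u hu => ?_⟩, fun u hu huE => ?_, ?_⟩
  · obtain ⟨a, -, h⟩ := (mem_D u).1 hu
    exact hG.2 u (hg.mem_of_pairMem h).2
  · obtain ⟨a, -, h⟩ := (mem_D u).1 hu
    have key : Mem u (d a) ↔ ¬ Mem u (d a) := by
      rw [mem_d]
      constructor
      · rintro ⟨-, h', hu', hu''⟩ hu₁
        obtain ⟨rfl, -⟩ := g_inj h hu'
        exact hu'' ((mem_d a u).2 hu₁)
      · intro hu'
        exact ⟨huE, d a, h, fun h => hu' ((mem_d a u).1 h)⟩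
    exact iff_not_self key
  · refine equinum_of_rel hx (isSet_compr _) (fun a u => PairMem g (pr (d a) a) u)
      (fun a ha => ?_) (fun u hu => (mem_D u).1 hu) (fun a b c ha _ _ hb hc => ?_)
      (fun u a b _ _ _ h h' => (g_inj h h').2)
    · obtain ⟨u, hu, -⟩ := hg.2.2.1 (pr (d a) a) (mem_relSet.2
        ⟨d a, a, mem_power.2 ⟨isSet_compr _, fun e he => ((mem_d a e).1 he).1⟩, ha, trivial, rfl⟩)
      exact ⟨u, (mem_D u).2 ⟨a, ha, hu⟩, hu⟩
    · exact (hg.2.2.1 _ (hg.mem_of_pairMem hb).1).unique hb hc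

/-- `C` and `D` may overlap, so a direct swap is unavailable; two swaps through a third copy,
disjoint from `X`, `C` and `D`, compose to the required map. -/
theorem exists_automorphism_fixing (hplen : PlenitudePlus M) {X C D : M} (hC : IsSetOfUr C)
    (hD : IsSetOfUr D) (hCX : Disj C X) (hDX : Disj D X) (h : Equinum C D) :
    ∃ σ : M ≃[lang] M, σ C = D ∧ (∀ y, Over X y → σ y = y) ∧ ∀ y, IsSet y → Equinum y (σ y) := by
  obtain ⟨E, hE, hEX, hCE⟩ := exists_disjoint_copy hplen hC.1 (union X (union C D))
  have hE' : ∀ z, Mem z E → ¬ Mem z X ∧ ¬ Mem z C ∧ ¬ Mem z D := fun z hz => by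
    simpa [mem_union] using hEX z hz
  obtain ⟨σ, hσ, hσX, hσE⟩ := exists_automorphism_swap hC hE
    (fun z hz hz' => (hE' z hz').2.1 hz) hCE
  obtain ⟨τ, hτ, hτX, hτE⟩ := exists_automorphism_swap hE hD (fun z hz => (hE' z hz).2.2)
    (hCE.symm.trans h)
  refine ⟨τ.comp σ, ?_, fun y hy => ?_, fun y hy => ?_⟩
  · rw [Language.Equiv.comp_apply, hσ, hτ]
  · rw [Language.Equiv.comp_apply, hσX X hCX (fun z hz => (hE' z hz).1) y hy,
      hτX X (fun z hz => (hE' z hz).1) hDX y hy]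
  · exact (hσE y hy).trans (hτE _ fun h => hy ((isUr_map σ y).1 h))

/-- The set of all urelements in the transitive closure of `{y}`. -/
noncomputable def ker (y : M) : M := compr fun a => Mem a (tc y) ∧ IsUr a

instance DfnFun.ker {t : (ι → M) → M} [DfnFun A t] : DfnFun A (fun v => ker (t v)) :=
  DfnFun.comp₁ (by unfold Urelement.ker; infer_instance)

theorem mem_ker {y a : M} : Mem a (ker y) ↔ Mem a (tc y) ∧ IsUr a :=
  mem_compr (P := fun a => Mem a (tc y) ∧ IsUr a) (fun _ h => h.1) a

theorem isSetOfUr_ker (y : M) : IsSetOfUr (ker y) :=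
  ⟨isSet_compr _, fun _ h => (mem_ker.1 h).2⟩

theorem over_iff_ker_sub {X y : M} : Over X y ↔ Sub (ker y) X := by
  simp only [Over, Sub, mem_ker]
  exact ⟨fun h a ha => h a ha.2 ha.1, fun h a ha hay => h a ⟨hay, ha⟩⟩

theorem isSetOfUr_union {X Y : M} (hX : IsSetOfUr X) (hY : IsSetOfUr Y) : IsSetOfUr (union X Y) :=
  ⟨isSet_union X Y, fun a ha => (mem_union.1 ha).elim (hX.2 a) (hY.2 a)⟩

theorem isSetOfUr_singleton {a : M} (ha : IsUr a) : IsSetOfUr (upair a a) :=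
  ⟨isSet_upair a a, fun b hb => by
    rcases mem_upair.1 hb with rfl | rfl <;> exact ha⟩

theorem exists_urelement_not_mem (hplen : PlenitudePlus M) (E : M) : ∃ a, IsUr a ∧ ¬ Mem a E := by
  obtain ⟨D, hD, hDE, -, -, f, hf⟩ := exists_disjoint_copy hplen (isSet_upair emp emp) E
  obtain ⟨a, ha, -⟩ := hf.2.2.1 emp (mem_upair.2 (Or.inl rfl))
  have := (hf.mem_of_pairMem ha).2
  exact ⟨a, hD.2 a this, hDE a this⟩

/-- If cardinality is parametrically representable, then there is a set `X` of urelements such that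
every set has a copy over `X`: all urelements involved in the cardinals are involved in the
parameter, since the other urelements are indiscernible. -/
theorem exists_copy_over (hcard : CardParamRepresentable M) (hplen : PlenitudePlus M) :
    ∃ X : M, IsSetOfUr X ∧ ∀ x, IsSet x → ∃ c, Equinum x c ∧ Over X c := by
  obtain ⟨p, card, hdef, hiff, hequ⟩ := hcard
  refine ⟨ker p, isSetOfUr_ker p, fun x hx => ⟨card x, hequ x hx, fun a ha hac => ?_⟩⟩
  by_contra hap
  obtain ⟨b, hb, hb'⟩ := exists_urelement_not_mem hplen (union (ker p) (ker (card x)))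
  simp only [mem_union, not_or] at hb'
  have disj : ∀ {c : M}, ¬ Mem c (ker p) → Disj (upair c c) (ker p) := fun hc z hz => by
    rcases mem_upair.1 hz with rfl | rfl <;> exact hc
  obtain ⟨σ, hσ, hσp, hσE⟩ := exists_automorphism_fixing hplen (isSetOfUr_singleton ha)
    (isSetOfUr_singleton hb) (disj hap) (disj hb'.1)
    (equinum_of_rel (isSet_upair a a) (isSet_upair b b) (fun _ _ => True)
      (fun _ _ => ⟨b, mem_upair.2 (Or.inl rfl), trivial⟩)
      (fun _ _ => ⟨a, mem_upair.2 (Or.inl rfl), trivial⟩)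
      (fun _ c d _ hc hd _ _ => by simp only [mem_upair, or_self] at hc hd; rw [hc, hd])
      (fun _ c d _ hc hd _ _ => by simp only [mem_upair, or_self] at hc hd; rw [hc, hd]))
  have hσab : σ a = b := by
    have : Mem (σ a) (σ (upair a a)) := (mem_map σ _ _).2 (mem_upair.2 (Or.inl rfl))
    simpa only [hσ, mem_upair, or_self] using this
  have hσx : IsSet (σ x) := fun h => hx ((isUr_map σ x).1 h)
  -- As `σ` fixes `p`, it commutes with `card` at `x`; and `σ x` is equinumerous with `x`, so it has
  -- the same cardinal.
  have h₁ : σ (card x) = card x := by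
    have hD : Dfn {p} (fun v : Fin 2 → M => IsSet (v 0) ∧ v 1 = card (v 0)) := ⟨hdef⟩
    have := (hD.map_iff σ (fun q hq => by
      obtain rfl := hq
      exact hσp q (over_iff_ker_sub.2 fun _ h => h)) ![x, card x]).2 ⟨hx, rfl⟩
    exact this.2.trans ((hiff x (σ x) hx hσx).1 (hσE x hx)).symm
  -- Applying `σ` to the membership of `a` in the kernel of `card x` puts `b` there, against the
  -- choice of `b`.
  have hD : Dfn ∅ (fun v : Fin 2 → M => Mem (v 0) (ker (v 1))) := inferInstance
  have := (hD.map_iff σ (fun q hq => absurd hq (Set.notMem_empty q)) ![a, card x]).2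
    (mem_ker.2 ⟨hac, ha⟩)
  refine hb'.2 ?_
  change Mem (σ a) (ker (σ (card x))) at this
  rwa [hσab, h₁] at this

end Plenitude

/-! ### Bounding ranks in place of Collection -/

section Bounding

variable {M : Type*} [lang.Structure M] [hM : Fact (IsModelZFUR M)]

theorem not_rankLE_pr (s u : M) : ¬ RankLE (pr s u) s := by
  intro h
  obtain ⟨x, hx, h⟩ := rankLE_iff.1 h (upair s s) (mem_upair.2 (Or.inl rfl))
  obtain ⟨y, hy, h⟩ := rankLE_iff.1 h s (mem_upair.2 (Or.inl rfl))
  exact not_rankLE_of_mem hx (h.trans (rankLE_of_mem hy))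

/-- Replacing `u` by the pair `(s, u)` is injective, raises the rank above that of `s`, and needs no
new urelements. -/
theorem exists_copy_above {X s c : M} (hs : Over X s) (hc : Over X c) (hc' : IsSet c) :
    ∃ c', Equinum c c' ∧ Over X c' ∧ ∀ u, Mem u c' → ¬ RankLE u s := by
  obtain ⟨c', hc'', h⟩ := exists_replacement (fun u q : M => q = pr s u) c
    fun u _ => ⟨_, rfl, fun _ h => h⟩
  refine ⟨c', ?_, over_of_isSet hc'' fun q hq => ?_, fun q hq => ?_⟩
  · exact equinum_of_fun hc' hc'' (fun u => pr s u) (fun a ha => (h _).2 ⟨a, ha, rfl⟩)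
      (fun b hb => (h b).1 hb) (fun a b _ _ hab => (pr_inj.1 hab).2)
  · obtain ⟨u, hu, rfl⟩ := (h q).1 hq
    exact over_pr hs (hc.mem hu)
  · obtain ⟨u, -, rfl⟩ := (h q).1 hq
    exact not_rankLE_pr s u

/-- There need not be a unique `r` of least rank for a given `a`, but the level with index `r` over
`X` depends only on the rank of `r`. So Replacement collects these levels, and their union bounds
all the ranks. -/
theorem exists_bound (X w : M) (Q : M → M → Prop)
    [Dfn Set.univ (fun v : Fin 2 → M => Q (v 0) (v 1))]
    (mono : ∀ a r r', RankLE r r' → Q a r → Q a r')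
    (h : ∀ a, Mem a w → ∃ r, Over X r ∧ Q a r) : ∃ r, Over X r ∧ ∀ a, Mem a w → Q a r := by
  have := fun {ι : Type} => @Dfn.comp₂ M _ Set.univ ι Q inferInstance
  have least : ∀ a, Mem a w → ∃ r, (Over X r ∧ Q a r) ∧ ∀ r', Over X r' ∧ Q a r' → RankLE r r' :=
    fun a ha => exists_rankLE_least (fun r => Over X r ∧ Q a r) (h a ha)
  obtain ⟨W, -, hW⟩ := exists_replacement (fun a y : M => ∃ r, (Over X r ∧ Q a r) ∧
      (∀ r', Over X r' ∧ Q a r' → RankLE r r') ∧ y = level r X) w fun a ha => by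
    obtain ⟨r, hr, hr'⟩ := least a ha
    refine ⟨_, ⟨r, hr, hr', rfl⟩, ?_⟩
    rintro _ ⟨s, hs, hs', rfl⟩
    exact ext_of_isSet (isSet_level _ _) (isSet_level _ _) fun z =>
      ⟨level_sub_level (hs' r hr) (fun _ h => h) z, level_sub_level (hr' s hs) (fun _ h => h) z⟩
  refine ⟨sUnion W, over_of_isSet (isSet_compr _) fun z hz => ?_, fun a ha => ?_⟩
  · obtain ⟨y, hy, hz⟩ := mem_sUnion.1 hz
    obtain ⟨a, -, r, -, -, rfl⟩ := (hW y).1 hy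
    exact (mem_level.1 hz).2
  · obtain ⟨r, hr, hr'⟩ := least a ha
    exact mono a r _ ((rankLE_level hr.1).trans (rankLE_of_sub fun z hz =>
      mem_sUnion.2 ⟨_, (hW _).2 ⟨a, ha, r, hr, hr', rfl⟩, hz⟩)) hr.2

instance Dfn.forall_finite {A : Set M} {ι κ : Type} [Finite κ] {P : (ι → M) → κ → Prop}
    [h : ∀ k, Dfn A (fun v => P v k)] : Dfn A (fun v => ∀ k, P v k) :=
  ⟨by rw [Set.ofPred_forall]; exact Set.definable_iInter_of_finite fun k => (h k).definable⟩

theorem exists_bound_tuple (X w : M) {k : ℕ} (Q : (Fin k → M) → M → Prop)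
    (hQ : Dfn Set.univ (fun v : Option (Fin k) → M => Q (fun i => v (some i)) (v none)))
    (mono : ∀ u r r', RankLE r r' → Q u r → Q u r')
    (h : ∀ u, (∀ i, Mem (u i) w) → ∃ r, Over X r ∧ Q u r) :
    ∃ r, Over X r ∧ ∀ u, (∀ i, Mem (u i) w) → Q u r := by
  induction k with
  | zero =>
    obtain ⟨r, hr, hQr⟩ := h Fin.elim0 fun i => i.elim0
    exact ⟨r, hr, fun u _ => Subsingleton.elim Fin.elim0 u ▸ hQr⟩
  | succ k ih =>
    have : Dfn Set.univ (fun v : Fin 2 ⊕ Fin k → M =>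
        Q (Fin.cons (v (Sum.inl 0)) fun i => v (Sum.inr i)) (v (Sum.inl 1))) := by
      have := hQ.relabel (fun o => Option.elim o (Sum.inl 1)
        (Fin.cons (Sum.inl 0) Sum.inr : Fin (k + 1) → Fin 2 ⊕ Fin k))
      refine Dfn.congr (h := this) fun v => iff_of_eq (congrArg (fun u => Q u _) ?_)
      funext i
      cases i using Fin.cases <;> rfl
    obtain ⟨r, hr, hr'⟩ := exists_bound X w
      (fun a r => ∀ u : Fin k → M, (∀ i, Mem (u i) w) → Q (Fin.cons a u) r)
      (fun a r r' hrr' hr u hu => mono _ r r' hrr' (hr u hu)) (fun a ha => by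
        refine ih (fun u r => Q (Fin.cons a u) r) ?_ (fun u => mono _) fun u hu => h _ fun i => ?_
        · have : Dfn Set.univ (fun v : Option (Fin k) → M =>
              Q (fun i => (Fin.cons a fun i => v (some i) : Fin (k + 1) → M) i) (v none)) := by
            refine hQ.comp (t := fun o v => Option.elim o (v none)
              (Fin.cons a fun i => v (some i) : Fin (k + 1) → M)) ?_
            rintro (_ | i)
            · exact DfnFun.var none
            · cases i using Fin.cases
              · exact DfnFun.const a
              · exact DfnFun.var _
          exact this
        · cases i using Fin.cases
          · exact ha
          · exact hu _)
    refine ⟨r, hr, fun u hu => ?_⟩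
    rw [← Fin.cons_self_tail u]
    exact hr' (u 0) (hu 0) _ fun i => hu _

/-- Indices built over `X` thus suffice to measure every rank; such indices are fixed by
automorphisms that fix everything over `X`. -/
theorem exists_rankLE_over (X z : M) : ∃ r, Over X r ∧ RankLE z r := by
  refine mem_induction (P := fun z : M => ∃ r, Over X r ∧ RankLE z r) (fun z ih => ?_) z
  obtain ⟨r, hr, h⟩ := exists_bound X z (fun a r => RankLE a r) (fun a r r' hr h => h.trans hr) ih
  exact ⟨upair r r, over_upair hr hr, rankLE_iff.2 fun a ha =>
    ⟨r, mem_upair.2 (Or.inl rfl), h a ha⟩⟩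

end Bounding

/-! ### One closure step, uniform in the set of fresh urelements -/

section Step

theorem dfn_tuple {M : Type*} [lang.Structure M] {k : ℕ} {Ψ : (Fin k → M) → M → Prop} {A : Set M}
    {ι : Type}
    (hΨ : Dfn A (fun v : Option (Fin k) → M => Ψ (fun i => v (some i)) (v none)))
    {t : Fin k → (ι → M) → M} {s : (ι → M) → M} [ht : ∀ i, DfnFun A (t i)] [hs : DfnFun A s] :
    Dfn A (fun v => Ψ (fun i => t i v) (s v)) :=
  hΨ.comp (t := fun o => Option.elim o s t) (by rintro (_ | i); exacts [hs, ht i])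

variable {M : Type*} [lang.Structure M] [hM : Fact (IsModelZFUR M)] {k : ℕ}

/-- Whenever `Ψ u` has a witness, where `u` is a tuple from the level with index `s` over `B ∪ D`,
it has one in the level with index `s'` over `B ∪ D ∪ C`, for some set `C` of further urelements
which is equinumerous with a subset of the level with index `s'` over `B` that is disjoint from the
level with index `s`. -/
def Catches (Ψ : (Fin k → M) → M → Prop) (B D s s' : M) : Prop :=
  ∀ u : Fin k → M, (∀ i, Mem (u i) (level s (union B D))) → (∃ z, Ψ u z) → ∃ z, Ψ u z ∧
    ∃ C c, IsSetOfUr C ∧ Disj C (union B D) ∧ Sub c (level s' B) ∧ Disj c (level s B) ∧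
      Equinum C c ∧ Mem z (level s' (union (union B D) C))

/-- `Catches` holds for all sets `D` of urelements outside of `B` that are equinumerous with the
level with index `s` over `B`. -/
def Step (Ψ : (Fin k → M) → M → Prop) (B s s' : M) : Prop :=
  ∀ D, IsSetOfUr D → Disj D B → Equinum D (level s B) → Catches Ψ B D s s'

variable {Ψ : (Fin k → M) → M → Prop}

theorem dfn_catches {A : Set M}
    (hΨ : Dfn A (fun v : Option (Fin k) → M => Ψ (fun i => v (some i)) (v none))) :
    Dfn A (fun v : Fin 4 → M => Catches Ψ (v 0) (v 1) (v 2) (v 3)) := by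
  have := fun {ι : Type} => @dfn_tuple M _ k Ψ A ι hΨ
  have : Dfn A (fun w : Option ((Fin 4) ⊕ (Fin k)) → M =>
      Ψ (fun i => w (some (Sum.inr i))) (w none)) :=
    dfn_tuple hΨ (t := fun i w => w (some (Sum.inr i)))
  unfold Catches
  infer_instance

theorem dfn_step {A : Set M}
    (hΨ : Dfn A (fun v : Option (Fin k) → M => Ψ (fun i => v (some i)) (v none))) :
    Dfn A (fun v : Fin 3 → M => Step Ψ (v 0) (v 1) (v 2)) := by
  have := fun {ι : Type} => @Dfn.comp₄ M _ A ι _ (dfn_catches hΨ)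
  unfold Step
  infer_instance

theorem Step.mono {B s r r' : M} (hr : RankLE r r') (h : Step Ψ B s r) : Step Ψ B s r' := by
  intro D hD hDB hDs u hu hz
  obtain ⟨z, hz, C, c, hC, hCB, hc, hcs, hCc, hzC⟩ := h D hD hDB hDs u hu hz
  exact ⟨z, hz, C, c, hC, hCB, fun x hx => level_sub_level hr (fun _ h => h) x (hc x hx), hcs, hCc,
    level_sub_level hr (fun _ h => h) z hzC⟩

theorem disj_union {X Y Z : M} : Disj X (union Y Z) ↔ Disj X Y ∧ Disj X Z := by
  simp only [Disj, mem_union, not_or]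
  exact ⟨fun h => ⟨fun z hz => (h z hz).1, fun z hz => (h z hz).2⟩,
    fun h z hz => ⟨h.1 z hz, h.2 z hz⟩⟩

/-- A bound is found for one fresh set `D₀`. It is valid for every admissible `D`, because an
automorphism that fixes everything over `B` carries `D₀` to `D`, and `Catches` is definable without
parameters. -/
theorem exists_step (hplen : PlenitudePlus M) {B : M} (hB : IsSetOfUr B)
    (hcopy : ∀ x, IsSet x → ∃ c, Equinum x c ∧ Over B c)
    (hΨ : Dfn ∅ (fun v : Option (Fin k) → M => Ψ (fun i => v (some i)) (v none)))
    {s : M} (hs : Over B s) : ∃ r, Over B r ∧ Step Ψ B s r := by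
  obtain ⟨D₀, hD₀, hD₀B, hD₀s⟩ := exists_disjoint_copy hplen (isSet_level s B) B
  have hΨ' := hΨ.mono (Set.empty_subset (Set.univ : Set M))
  let Q : (Fin k → M) → M → Prop := fun u r => (∃ z, Ψ u z) → ∃ z, Ψ u z ∧
    ∃ C c, IsSetOfUr C ∧ Disj C (union B D₀) ∧ Sub c (level r B) ∧ Disj c (level s B) ∧
      Equinum C c ∧ Mem z (level r (union (union B D₀) C))
  obtain ⟨r, hr, h⟩ := exists_bound_tuple B (level s (union B D₀)) Q (by
    have : Dfn Set.univ (fun w : Option (Option (Fin k)) → M =>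
        Ψ (fun i => w (some (some i))) (w none)) :=
      dfn_tuple hΨ' (t := fun i w => w (some (some i)))
    unfold Q
    infer_instance) (by
    rintro u r r' hrr' h hz
    obtain ⟨z, hz, C, c, hC, hCB, hc, hcs, hCc, hzC⟩ := h hz
    exact ⟨z, hz, C, c, hC, hCB, fun x hx => level_sub_level hrr' (fun _ h => h) x (hc x hx), hcs,
      hCc, level_sub_level hrr' (fun _ h => h) z hzC⟩) (by
    intro u hu
    by_cases hz : ∃ z, Ψ u z
    swap
    · exact ⟨s, hs, fun h => absurd h hz⟩
    obtain ⟨z, hz⟩ := hz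
    obtain ⟨r, hr, hzr⟩ := exists_rankLE_over B z
    -- `C` consists of the new urelements that the witness `z` uses. Its size is copied over `B`,
    -- above the rank of `s`.
    have mem_C := mem_compr (P := fun a => Mem a (ker z) ∧ ¬ Mem a (union B D₀)) fun _ h => h.1
    have hC : IsSet (compr fun a => Mem a (ker z) ∧ ¬ Mem a (union B D₀)) := isSet_compr _
    generalize compr (fun a => Mem a (ker z) ∧ ¬ Mem a (union B D₀)) = C at mem_C hC
    obtain ⟨c₀, hc₀, hc₀B⟩ := hcopy C hC
    obtain ⟨c, hc, hcB, hcs⟩ := exists_copy_above hs hc₀B hc₀.2.1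
    -- The index `union r c` is high enough both for `z` and for every member of `c`.
    have hrc : RankLE r (union r c) := rankLE_of_sub fun x hx => mem_union.2 (Or.inl hx)
    refine ⟨union r c, over_of_isSet (isSet_union r c) fun x hx => ?_, fun _ => ⟨z, hz, C, c,
      ⟨hC, fun a ha => (mem_ker.1 ((mem_C a).1 ha).1).2⟩, fun a ha => ((mem_C a).1 ha).2,
      fun x hx => mem_level.2 ⟨rankLE_of_mem (mem_union.2 (Or.inr hx)), hcB.mem hx⟩,
      fun x hx hx' => hcs x hx (mem_level.1 hx').1, hc₀.trans hc,
      mem_level.2 ⟨hzr.trans hrc, over_iff_ker_sub.2 fun a ha => ?_⟩⟩⟩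
    · exact (mem_union.1 hx).elim (fun hx => hr.mem hx) (fun hx => hcB.mem hx)
    · by_cases ha' : Mem a (union B D₀)
      · exact mem_union.2 (Or.inl ha')
      · exact mem_union.2 (Or.inr ((mem_C a).2 ⟨ha, ha'⟩)))
  refine ⟨r, hr, fun D hD hDB hDs => ?_⟩
  obtain ⟨σ, hσ, hσB, -⟩ := exists_automorphism_fixing hplen hD₀ hD hD₀B hDB
    (hD₀s.symm.trans hDs.symm)
  have key := (dfn_catches hΨ).map_iff σ (fun a ha => absurd ha (Set.notMem_empty a)) ![B, D₀, s, r]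
  change Catches Ψ (σ B) (σ D₀) (σ s) (σ r) ↔ Catches Ψ B D₀ s r at key
  rw [hσ, hσB s hs, hσB r hr, hσB B (hB.over fun _ h => h)] at key
  exact key.2 h

end Step

/-! ### Closure steps for all subformulas, and their iteration -/

section Reflection

variable {M : Type*} [lang.Structure M]

/-- The negation of `f`, as a relation between tuples and values of the last variable. -/
def Counterexample {m n : ℕ} (f : lang.BoundedFormula (Fin m) (n + 1)) (u : Fin (m + n) → M)
    (z : M) : Prop :=
  ¬ f.Realize (fun i => u (Fin.castAdd n i)) (Fin.snoc (fun j => u (Fin.natAdd m j)) z)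

theorem dfn_counterexample {m n : ℕ} (f : lang.BoundedFormula (Fin m) (n + 1)) (A : Set M) :
    Dfn A (fun v : Option (Fin (m + n)) → M => Counterexample f (fun i => v (some i)) (v none)) := by
  have h : Dfn A (fun v : Fin m ⊕ Fin (n + 1) → M =>
      f.Realize (fun i => v (Sum.inl i)) (fun j => v (Sum.inr j))) := by
    refine Dfn.mono (A := ∅) ⟨Set.empty_definable_iff.2 ⟨f.toFormula, ?_⟩⟩ (Set.empty_subset A)
    ext v
    exact (BoundedFormula.realize_toFormula f v).symm
  have h' := (h.relabel (Sum.elim (fun i => some (Fin.castAdd n i))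
    (Fin.snoc (fun j => some (Fin.natAdd m j)) none : Fin (n + 1) → Option (Fin (m + n)))))
  have := Dfn.not (hP := h')
  refine Dfn.congr (h := this) fun v => not_congr (iff_of_eq (congrArg _ ?_))
  funext j
  cases j using Fin.lastCases <;> simp

variable [hM : Fact (IsModelZFUR M)]

/-- `Step` holds for all subformulas of `φ`. -/
def StepFormula {m : ℕ} : {n : ℕ} → lang.BoundedFormula (Fin m) n → M → M → M → Prop
  | _, .falsum, _, _, _ => True
  | _, .equal _ _, _, _, _ => True
  | _, .rel _ _, _, _, _ => True
  | _, .imp f g, B, s, r => StepFormula f B s r ∧ StepFormula g B s r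
  | _, .all f, B, s, r => StepFormula f B s r ∧ Step (Counterexample f) B s r

theorem StepFormula.dfn {m n : ℕ} (φ : lang.BoundedFormula (Fin m) n) (A : Set M) :
    Dfn A (fun v : Fin 3 → M => StepFormula φ (v 0) (v 1) (v 2)) := by
  induction φ with
  | falsum => exact Dfn.const True
  | equal => exact Dfn.const True
  | rel => exact Dfn.const True
  | imp f g hf hg => exact Dfn.and
  | all f hf =>
    have := dfn_step (dfn_counterexample f A)
    exact Dfn.and

theorem StepFormula.mono {m n : ℕ} {φ : lang.BoundedFormula (Fin m) n} {B s r r' : M}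
    (hr : RankLE r r') (h : StepFormula φ B s r) : StepFormula φ B s r' := by
  induction φ with
  | falsum => trivial
  | equal => trivial
  | rel => trivial
  | imp f g hf hg => exact ⟨hf h.1, hg h.2⟩
  | all f hf => exact ⟨hf h.1, h.2.mono hr⟩

theorem exists_stepFormula (hplen : PlenitudePlus M) {B : M} (hB : IsSetOfUr B)
    (hcopy : ∀ x, IsSet x → ∃ c, Equinum x c ∧ Over B c) {m n : ℕ}
    (φ : lang.BoundedFormula (Fin m) n) {s : M} (hs : Over B s) :
    ∃ r, Over B r ∧ StepFormula φ B s r := by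
  have aux : ∀ {P Q : M → Prop}, (∀ r r', RankLE r r' → P r → P r') →
      (∀ r r', RankLE r r' → Q r → Q r') → (∃ r, Over B r ∧ P r) → (∃ r, Over B r ∧ Q r) →
      ∃ r, Over B r ∧ P r ∧ Q r := by
    rintro P Q hP hQ ⟨r, hr, hPr⟩ ⟨r', hr', hQr'⟩
    rcases rankLE_total r r' with h | h
    · exact ⟨r', hr', hP _ _ h hPr, hQr'⟩
    · exact ⟨r, hr, hPr, hQ _ _ h hQr'⟩
  induction φ with
  | falsum => exact ⟨s, hs, trivial⟩
  | equal => exact ⟨s, hs, trivial⟩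
  | rel => exact ⟨s, hs, trivial⟩
  | imp f g hf hg => exact aux (fun _ _ => .mono) (fun _ _ => .mono) hf hg
  | all f hf =>
    exact aux (fun _ _ => StepFormula.mono) (fun _ _ => Step.mono) hf
      (exists_step hplen hB hcopy (dfn_counterexample f ∅) hs)

/-- There is a set of indices that contains `x` and is closed under `StepFormula φ`. -/
theorem exists_stepFormula_orbit (hplen : PlenitudePlus M) {B x : M} (hB : IsSetOfUr B)
    (hcopy : ∀ x, IsSet x → ∃ c, Equinum x c ∧ Over B c) {m n : ℕ}
    (φ : lang.BoundedFormula (Fin m) n) (hx : Over B x) :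
    ∃ T, Mem x T ∧ (∀ s, Mem s T → Over B s) ∧
      ∀ s, Mem s T → ∃ r, Mem r T ∧ StepFormula φ B s r := by
  have hφ := fun {ι : Type} => @Dfn.comp₃ M _ Set.univ ι _ (StepFormula.dfn φ Set.univ)
  -- The successor of `s` is a whole level rather than an index of least rank: the level is unique,
  -- as `exists_orbit` requires, and it can itself serve as an index of no smaller rank.
  let R : M → M → Prop := fun s y => ∃ r, (Over B r ∧ StepFormula φ B s r) ∧
    (∀ r', Over B r' ∧ StepFormula φ B s r' → RankLE r r') ∧ y = level r B
  have hR : Dfn Set.univ (fun v : Fin 2 → M => R (v 0) (v 1)) := by unfold R; infer_instance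
  have hR' : ∀ s, Over B s → ∃! y, R s y := fun s hs => by
    obtain ⟨r, hr, hr'⟩ := exists_rankLE_least (fun r => Over B r ∧ StepFormula φ B s r)
      (exists_stepFormula hplen hB hcopy φ hs)
    refine ⟨_, ⟨r, hr, hr', rfl⟩, ?_⟩
    rintro _ ⟨q, hq, hq', rfl⟩
    exact ext_of_isSet (isSet_level _ _) (isSet_level _ _) fun z =>
      ⟨level_sub_level (hq' r hr) (fun _ h => h) z, level_sub_level (hr' q hq) (fun _ h => h) z⟩
  obtain ⟨T, -, hx, hT, h⟩ := exists_orbit R (Over B) hx hR'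
    (fun s y _ ⟨r, _, _, hy⟩ => hy ▸ over_level r B)
  refine ⟨T, hx, hT, fun s hs => ?_⟩
  obtain ⟨_, hy, r, hr, -, rfl⟩ := h s hs
  exact ⟨_, hy, hr.2.mono (rankLE_level hr.1)⟩

end Reflection

/-! ### The Tarski–Vaught criterion and the reflecting set -/

section Main

variable {M : Type*} [lang.Structure M]

/-- The Tarski–Vaught test. The predicate `P` abstracts a closure property of `t` that is inherited
by subformulas and yields counterexamples in `t` to universal formulas that fail. -/
theorem realize_relativize {t : M} {m n : ℕ} (φ : lang.BoundedFormula (Fin m) n)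
    (P : {n : ℕ} → lang.BoundedFormula (Fin m) n → Prop)
    (himp : ∀ {n} (f g : lang.BoundedFormula (Fin m) n), P (f.imp g) → P f ∧ P g)
    (hall : ∀ {n} (f : lang.BoundedFormula (Fin m) (n + 1)), P f.all → P f ∧
      ∀ u : Fin (m + n) → M, (∀ i, Mem (u i) t) → (∃ z, Counterexample f u z) →
        ∃ z, Mem z t ∧ Counterexample f u z)
    (hφ : P φ) (v : Fin m → M) (xs : Fin n → M) (hv : ∀ i, Mem (v i) t) (hxs : ∀ i, Mem (xs i) t) :
    φ.Realize v xs ↔ (relativize φ).Realize (fun o => Option.elim o t v) xs := by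
  have hterm : ∀ {n} (s : lang.Term (Fin m ⊕ Fin n)) (xs : Fin n → M),
      (s.relabel (Sum.map some id)).realize (Sum.elim (fun o => Option.elim o t v) xs) =
        s.realize (Sum.elim v xs) := fun s xs => by
    rw [Term.realize_relabel]
    congr 1
    funext i
    rcases i with i | i <;> rfl
  induction φ with
  | falsum => exact Iff.rfl
  | equal s₁ s₂ => simp only [relativize, BoundedFormula.Realize, hterm]
  | rel R ts => simp only [relativize, BoundedFormula.Realize, hterm]
  | imp f g hf hg =>
    obtain ⟨hPf, hPg⟩ := himp f g hφ
    exact imp_congr (hf hPf xs hxs) (hg hPg xs hxs)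
  | @all n f hf =>
    obtain ⟨hPf, hw⟩ := hall f hφ
    have hsnoc : ∀ z, Mem z t → ∀ i, Mem ((Fin.snoc xs z : Fin (n + 1) → M) i) t := fun z hz i => by
      cases i using Fin.lastCases <;> simp [hz, hxs]
    have hbound : ∀ z, (BoundedFormula.rel (Symb.mem : lang.Relations 2)
        ![Term.var (Sum.inr (Fin.last n)), Term.var (Sum.inl none)] :
          lang.BoundedFormula (Option (Fin m)) (n + 1)).Realize (fun o => Option.elim o t v)
          (Fin.snoc xs z) ↔ Mem z t := fun z => by
      refine iff_of_eq (congrArg (Structure.RelMap (L := lang) (Symb.mem : lang.Relations 2)) ?_)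
      funext i
      fin_cases i <;> simp
    change (∀ z, f.Realize v (Fin.snoc xs z)) ↔ ∀ z, _ → _
    simp only [hbound]
    constructor
    · exact fun h z hz => (hf hPf _ (hsnoc z hz)).1 (h z)
    · intro h
      by_contra! hz
      obtain ⟨z, hz⟩ := hz
      have hce : ∀ z, Counterexample f (Fin.append v xs) z ↔ ¬ f.Realize v (Fin.snoc xs z) :=
        fun z => by simp only [Counterexample, Fin.append_left, Fin.append_right]
      obtain ⟨y, hy, hy'⟩ := hw (Fin.append v xs)
        (fun i => by cases i using Fin.addCases <;> simp [hv, hxs]) ⟨z, (hce z).2 hz⟩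
      exact (hce y).1 hy' ((hf hPf _ (hsnoc y hy)).2 (h y hy))

variable [hM : Fact (IsModelZFUR M)]

/-- The image of `c` under `g`. -/
noncomputable def img (g c : M) : M := compr fun d => ∃ e, Mem e c ∧ PairMem g e d

instance DfnFun.img {A : Set M} {ι : Type} {t s : (ι → M) → M} [DfnFun A t] [DfnFun A s] :
    DfnFun A (fun v => img (t v) (s v)) :=
  DfnFun.comp₂ (by unfold Urelement.img; infer_instance)

theorem IsBij.mem_img {g E D : M} (hg : IsBij g E D) {c d : M} :
    Mem d (img g c) ↔ ∃ e, Mem e c ∧ PairMem g e d :=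
  mem_compr (P := fun d => ∃ e, Mem e c ∧ PairMem g e d)
    (fun _ ⟨_, _, h⟩ => (hg.mem_of_pairMem h).2) d

theorem IsBij.equinum_img {g E D : M} (hg : IsBij g E D) {c : M} (hc : IsSet c) (h : Sub c E) :
    Equinum c (img g c) := by
  refine equinum_of_rel hc (isSet_compr _) (fun e d => PairMem g e d) (fun e he => ?_)
    (fun d hd => hg.mem_img.1 hd) (fun e d d' he _ _ => (hg.2.2.1 e (h e he)).unique)
    (fun d e e' hd _ _ h => (hg.2.2.2 d (hg.mem_of_pairMem h).2).unique h)
  obtain ⟨d, hd, -⟩ := hg.2.2.1 e (h e he)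
  exact ⟨d, hg.mem_img.2 ⟨e, he, hd⟩, hd⟩

theorem IsBij.isSetOfUr_img {g E D : M} (hg : IsBij g E D) (hD : IsSetOfUr D) (c : M) :
    IsSetOfUr (img g c) :=
  ⟨isSet_compr _, fun d hd =>
    let ⟨_, _, h⟩ := hg.mem_img.1 hd
    hD.2 d (hg.mem_of_pairMem h).2⟩

theorem IsBij.img_sub {g E D : M} (hg : IsBij g E D) (c : M) : Sub (img g c) D := fun _ hd =>
  let ⟨_, _, h⟩ := hg.mem_img.1 hd
  (hg.mem_of_pairMem h).2

theorem IsBij.img_mono {g E D : M} (hg : IsBij g E D) {c c' : M} (h : Sub c c') :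
    Sub (img g c) (img g c') := fun _ hd =>
  let ⟨e, he, h'⟩ := hg.mem_img.1 hd
  hg.mem_img.2 ⟨e, h e he, h'⟩

theorem IsBij.disj_img {g E D : M} (hg : IsBij g E D) {c c' : M} (h : Disj c c') :
    Disj (img g c) (img g c') := fun d hd hd' => by
  obtain ⟨e, he, hed⟩ := hg.mem_img.1 hd
  obtain ⟨e', he', hed'⟩ := hg.mem_img.1 hd'
  obtain rfl := (hg.2.2.2 d (hg.mem_of_pairMem hed).2).unique hed hed'
  exact h e he he'

/-- The level with index `s` over the urelements in `B` and in the image of the level with index `s`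
over `B` under `g`. -/
noncomputable def growingLevel (B g s : M) : M := level s (union B (img g (level s B)))

instance DfnFun.growingLevel {A : Set M} {ι : Type} {t s r : (ι → M) → M} [DfnFun A t] [DfnFun A s]
    [DfnFun A r] : DfnFun A (fun v => growingLevel (t v) (s v) (r v)) := by
  have : DfnFun A (fun v : Fin 3 → M => Urelement.growingLevel (v 0) (v 1) (v 2)) := by
    unfold Urelement.growingLevel; infer_instance
  exact this.comp (t := ![t, s, r])
    (by simpa [Fin.forall_fin_succ] using! ⟨inferInstance, inferInstance, inferInstance⟩)

theorem IsBij.growingLevel_mono {B T D g : M} (hg : IsBij g (level T B) D) {s r : M}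
    (h : RankLE s r) : Sub (growingLevel B g s) (growingLevel B g r) :=
  level_sub_level h fun a ha => mem_union.2 <| (mem_union.1 ha).imp_right fun ha =>
    hg.img_mono (level_sub_level h fun _ h => h) a ha

/-- A witness caught in a step can be moved into the next `growingLevel`. -/
theorem exists_mem_growingLevel (hplen : PlenitudePlus M) {B T D g : M} (hB : IsSetOfUr B)
    (hD : IsSetOfUr D) (hDB : Disj D B) (hg : IsBij g (level T B) D) {k : ℕ}
    {Ψ : (Fin k → M) → M → Prop}
    (hΨ : Dfn ∅ (fun v : Option (Fin k) → M => Ψ (fun i => v (some i)) (v none))) {s r : M}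
    (hs : Mem s T) (hr : Mem r T) (hrB : Over B r) (hsr : RankLE s r) (h : Step Ψ B s r)
    {u : Fin k → M} (hu : ∀ i, Mem (u i) (growingLevel B g s)) (hz : ∃ z, Ψ u z) :
    ∃ z, Mem z (growingLevel B g r) ∧ Ψ u z := by
  have sub_top : ∀ {q}, Mem q T → Sub (level q B) (level T B) := fun hq =>
    level_sub_level (rankLE_of_mem hq) fun _ h => h
  have himg : ∀ c, Disj (img g c) B := fun c d hd => hDB d (hg.img_sub c d hd)
  obtain ⟨z, hz, C, c, hC, hCB, hc, hcs, hCc, hzC⟩ := h _ (hg.isSetOfUr_img hD (level s B))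
    (himg _) (hg.equinum_img (isSet_level s B) (sub_top hs)).symm u hu hz
  -- Here it matters that `c` avoids V_s(B): the urelements reserved for the witness must not
  -- already occur at stage `s`.
  have hcX : Disj (img g c) (union B (img g (level s B))) :=
    disj_union.2 ⟨himg c, hg.disj_img hcs⟩
  obtain ⟨σ, hσ, hσX, -⟩ := exists_automorphism_fixing hplen hC (hg.isSetOfUr_img hD c) hCB hcX
    (hCc.trans (hg.equinum_img hCc.2.1 fun x hx => sub_top hr x (hc x hx)))
  have hBX : Sub B (union B (img g (level s B))) := fun a ha => mem_union.2 (Or.inl ha)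
  have hXX : σ (union B (img g (level s B))) = union B (img g (level s B)) :=
    hσX _ ((isSetOfUr_union hB (hg.isSetOfUr_img hD _)).over fun _ h => h)
  refine ⟨σ z, ?_, ?_⟩
  · have hdfn : Dfn ∅ (fun v : Fin 4 → M => Mem (v 0) (level (v 1) (union (v 2) (v 3)))) :=
      inferInstance
    have := (hdfn.map_iff σ (fun q hq => absurd hq (Set.notMem_empty q))
      ![z, r, union B (img g (level s B)), C]).2 hzC
    change Mem (σ z) (level (σ r) (union (σ (union B (img g (level s B)))) (σ C))) at this
    rw [hσX r (hrB.mono hBX), hXX, hσ] at this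
    -- After the move all urelements of the witness lie in `B`, in g[V_s(B)] or in g[c], and the
    -- last two are parts of g[V_r(B)].
    refine level_sub_level (.refl r) (fun a ha => ?_) _ this
    rcases mem_union.1 ha with ha | ha
    · exact mem_union.2 ((mem_union.1 ha).imp_right fun ha =>
        hg.img_mono (level_sub_level hsr fun _ h => h) a ha)
    · exact mem_union.2 (Or.inr (hg.img_mono hc a ha))
  · have := (hΨ.map_iff σ (fun q hq => absurd hq (Set.notMem_empty q))
      (fun o => Option.elim o z u)).2 hz
    change Ψ (fun i => σ (u i)) (σ z) at this
    rwa [funext fun i => hσX (u i) (mem_level.1 (hu i)).2] at this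

theorem exists_common_level {B T D g x : M} (hg : IsBij g (level T B) D) (hx : Mem x T) {k : ℕ}
    (u : Fin k → M) (hu : ∀ i, ∃ s, Mem s T ∧ Mem (u i) (growingLevel B g s)) :
    ∃ s, Mem s T ∧ ∀ i, Mem (u i) (growingLevel B g s) := by
  induction k with
  | zero => exact ⟨x, hx, fun i => i.elim0⟩
  | succ k ih =>
    obtain ⟨s, hs, h⟩ := ih (fun i => u i.succ) fun i => hu _
    obtain ⟨r, hr, h'⟩ := hu 0
    rcases rankLE_total s r with hsr | hsr
    · exact ⟨r, hr, Fin.cases h' fun i => hg.growingLevel_mono hsr _ (h i)⟩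
    · exact ⟨s, hs, Fin.cases (hg.growingLevel_mono hsr _ h') h⟩

theorem reflection (hcard : CardParamRepresentable M) (hplen : PlenitudePlus M) :
    ReflectionPrinciple M := by
  intro n φ x hx
  obtain ⟨X, hX, hcopy⟩ := exists_copy_over hcard hplen
  obtain ⟨B, hB, hXB, hxB⟩ : ∃ B, IsSetOfUr B ∧ Sub X B ∧ Over B x :=
    ⟨union X (ker x), isSetOfUr_union hX (isSetOfUr_ker x), fun a ha => mem_union.2 (Or.inl ha),
      over_iff_ker_sub.2 fun a ha => mem_union.2 (Or.inr ha)⟩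
  obtain ⟨T, hxT, hTB, hT⟩ := exists_stepFormula_orbit hplen hB
    (fun y hy => (hcopy y hy).imp fun _ h => ⟨h.1, h.2.mono hXB⟩) φ hxB
  obtain ⟨D, hD, hDB, -, -, g, hg⟩ := exists_disjoint_copy hplen (isSet_level T B) B
  have mem_t := mem_compr (P := fun y => ∃ s, Mem s T ∧ Mem y (growingLevel B g s))
    (x := level T (union B D)) fun y ⟨s, hs, hy⟩ =>
      level_sub_level (rankLE_of_mem hs) (fun a ha => mem_union.2 <|
        (mem_union.1 ha).imp_right fun ha => hg.img_sub _ a ha) y hy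
  have ht : IsSet (compr fun y => ∃ s, Mem s T ∧ Mem y (growingLevel B g s)) := isSet_compr _
  generalize compr (fun y => ∃ s, Mem s T ∧ Mem y (growingLevel B g s)) = t at mem_t ht
  refine ⟨t, ⟨ht, fun y hy z hz => ?_⟩, fun z hz => ?_, fun v hv => ?_⟩
  · obtain ⟨s, hs, hy⟩ := (mem_t y).1 hy
    rw [growingLevel, mem_level] at hy
    exact (mem_t z).2 ⟨s, hs, mem_level.2 ⟨(rankLE_of_mem hz).trans hy.1, hy.2.mem hz⟩⟩
  -- The orbit was started at `x`, so `x` is itself an index, and the stage belonging to it contains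
  -- all members of `x`.
  · exact (mem_t z).2 ⟨x, hxT, mem_level.2 ⟨rankLE_of_mem hz,
      (hxB.mem hz).mono fun a ha => mem_union.2 (Or.inl ha)⟩⟩
  · refine realize_relativize φ (fun ψ => ∀ s, Mem s T → ∃ r, Mem r T ∧ StepFormula ψ B s r)
      (fun f g h => ⟨fun s hs => (h s hs).imp fun _ h => ⟨h.1, h.2.1⟩,
        fun s hs => (h s hs).imp fun _ h => ⟨h.1, h.2.2⟩⟩)
      (fun f h => ⟨fun s hs => (h s hs).imp fun _ h => ⟨h.1, h.2.1⟩, fun u hu hz => ?_⟩) hT v default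
      hv (fun i => i.elim0)
    obtain ⟨s, hs, hus⟩ := exists_common_level hg hxT u fun i => (mem_t _).1 (hu i)
    obtain ⟨r, hr, -, hstep⟩ := h s hs
    -- Nothing forces `r` to have rank at least that of `s`; if it does not, monotonicity lets `s`
    -- serve as its own next stage.
    rcases rankLE_total s r with hsr | hsr
    · obtain ⟨z, hz, hz'⟩ := exists_mem_growingLevel hplen hB hD hDB hg (dfn_counterexample f ∅)
        hs hr (hTB r hr) hsr hstep hus hz
      exact ⟨z, (mem_t z).2 ⟨r, hr, hz⟩, hz'⟩
    · obtain ⟨z, hz, hz'⟩ := exists_mem_growingLevel hplen hB hD hDB hg (dfn_counterexample f ∅)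
        hs hs (hTB s hs) (.refl s) (hstep.mono hsr) hus hz
      exact ⟨z, (mem_t z).2 ⟨s, hs, hz⟩, hz'⟩

end Main

end Urelement

theorem theorem2 {M : Type*} [Urelement.lang.Structure M]
    (hZFUR : Urelement.IsModelZFUR M)
    (hcard : Urelement.CardParamRepresentable M)
    (hplen : Urelement.PlenitudePlus M) :
    Urelement.ReflectionPrinciple M :=
  haveI : Fact (Urelement.IsModelZFUR M) := ⟨hZFUR⟩
  Urelement.reflection hcard hplen
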